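/- Throughout, a \emph{Pisot number} is a real algebraic integer greater than $1$ whose other conjugates all have modulus less than $1$, and a \emph{Salem number} is a real algebraic integer greater than $1$ whose other conjugates all have modulus at most $1$, at least one of them having modulus exactly $1$. For a real number $\rho>0$ and $|x|<1$ put $$\gamma(\rho;x)=\sum_{m=0}^{\infty}x^{\lfloor m^{\rho}\rfloor}.$$ For a power series $g(X)=\sum_{n\ge 0}t_nX^n$ put $S(g)=\{n\ge 0: t_n\neq 0\}$ and $\lambda(S(g);R)=\mathrm{Card}(S(g)\cap[0,R))$. Let $\mathcal F$ be the set of power series $g(X)$, not polynomials, such that (1) the coefficients of $g$ are bounded nonnegative integers; (2) for every $\varepsilon>0$, $\lambda(S(g);R)=o(R^{\varepsilon})$ as $R\to\infty$; (3) there is a constant $C>0$ such that $[R,CR]\cap S(g)\neq\emptyset$ for all sufficiently large real $R$. \textbf{Corollary.} There is an effectively computable function $\varepsilon\mapsto A_0(\varepsilon)$ from the positive reals to the positive reals with the following property. Let $\varepsilon>0$, let $A$ be an integer with $A\ge A_0(\varepsilon)$, and let $\rho$ be a real number with $\rho>(\varepsilon+1/2)A^2$. Then for every $g\in\mathcal F$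 and every Pisot or Salem number $\beta$, the numbers $$\gamma(\rho;\beta^{-1})^{k_1}\,g(\beta^{-1})^{k_2}\qquad (k_1,k_2\in\mathbb Z_{\ge 0},\ k_1\le A),$$ indexed by the pairs $(k_1,k_2)$, are linearly independent over $\mathbb Q(\beta)$. Here ``effectively computable'' means that $A_0$ is a computable real function on $(0,\infty)$: there are an algorithm that computes from positive integers $p,q$ and $n\ge 0$ an integer $F$ with $|A_0(p/q)-F/2^n|\le 2^{-n}$, and an algorithm that computes from $k,n\ge 0$ an integer $m\ge 0$ such that $|A_0(x)-A_0(y)|\le 2^{-n}$ for all $x,y\in[2^{-k},2^k]$ with $|x-y|\le 2^{-m}$. -/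

import Mathlib

/-- `β` is a Pisot number: a real algebraic integer greater than `1` all of whose other
(complex) conjugates have modulus less than `1`. -/
def IsPisot (β : ℝ) : Prop :=
  IsIntegral ℤ β ∧ 1 < β ∧
    ∀ z : ℂ, Polynomial.aeval z (minpoly ℚ β) = 0 → z ≠ (β : ℂ) → ‖z‖ < 1

/-- `β` is a Salem number: a real algebraic integer greater than `1` all of whose other
(complex) conjugates have modulus at most `1`, at least one of them having modulus `1`. -/
def IsSalem (β : ℝ) : Prop :=
  IsIntegral ℤ β ∧ 1 < β ∧
    (∀ z : ℂ, Polynomial.aeval z (minpoly ℚ β) = 0 → z ≠ (β : ℂ) → ‖z‖ ≤ 1) ∧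
    ∃ z : ℂ, Polynomial.aeval z (minpoly ℚ β) = 0 ∧ ‖z‖ = 1

/-- The value `γ(ρ; x) = ∑_{m ≥ 0} x ^ ⌊m ^ ρ⌋`. -/
noncomputable def gammaSeries (ρ x : ℝ) : ℝ :=
  ∑' m : ℕ, x ^ ⌊(m : ℝ) ^ ρ⌋₊

/-- The set `S(g)` of exponents at which the coefficient of `g` does not vanish. -/
def suppSet (g : PowerSeries ℕ) : Set ℕ :=
  {n | PowerSeries.coeff n g ≠ 0}

/-- `λ(𝒜; R)`, the number of elements of `𝒜` in `[0, R)`. -/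
noncomputable def countBelow (𝒜 : Set ℕ) (R : ℝ) : ℕ :=
  Set.ncard {n : ℕ | n ∈ 𝒜 ∧ (n : ℝ) < R}

/-- The value `g(x) = ∑_{n ≥ 0} t_n x ^ n` of a power series with nonnegative integer
coefficients `t_n` at a real number `x`. -/
noncomputable def seriesValue (g : PowerSeries ℕ) (x : ℝ) : ℝ :=
  ∑' n : ℕ, ((PowerSeries.coeff n g : ℕ) : ℝ) * x ^ n

/-- The class `𝓕` of nonpolynomial power series with bounded nonnegative integer coefficients,
with `λ(S(g); R) = o(R ^ ε)` for every `ε > 0`, and such that, for some constant `C > 0`,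
the interval `[R, C R]` meets `S(g)` for all sufficiently large `R`. -/
def classF : Set (PowerSeries ℕ) :=
  {g | (∀ p : Polynomial ℕ, (p : PowerSeries ℕ) ≠ g) ∧
    (∃ B : ℕ, ∀ n : ℕ, PowerSeries.coeff n g ≤ B) ∧
    (∀ ε : ℝ, 0 < ε →
      Asymptotics.IsLittleO Filter.atTop (fun R : ℝ => (countBelow (suppSet g) R : ℝ))
        (fun R : ℝ => R ^ ε)) ∧
    ∃ C : ℝ, 0 < C ∧ ∀ᶠ R : ℝ in Filter.atTop,
      (Set.Icc R (C * R) ∩ ((fun n : ℕ => (n : ℝ)) '' suppSet g)).Nonempty}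

/-- `f` restricted to `(0, ∞)` is a computable real function, in the usual sense of computable
analysis: an algorithm computes from positive integers `p, q` and a precision `n` an integer
`F (p, q, n)` with `|f (p / q) - F (p, q, n) / 2 ^ n| ≤ 2 ^ (-n)`, and another algorithm computes
a modulus of uniform continuity of `f` on each of the intervals `[2 ^ (-k), 2 ^ k]`. -/
def IsComputableOnPos (f : ℝ → ℝ) : Prop :=
  ∃ (F : ℕ × ℕ × ℕ → ℤ) (μ : ℕ × ℕ → ℕ), Computable F ∧ Computable μ ∧
    (∀ p q n : ℕ, 0 < p → 0 < q →
      |f ((p : ℝ) / (q : ℝ)) - (F (p, q, n) : ℝ) / 2 ^ n| ≤ 1 / 2 ^ n) ∧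
    ∀ (k n : ℕ) (x y : ℝ), x ∈ Set.Icc ((1 : ℝ) / 2 ^ k) (2 ^ k) →
      y ∈ Set.Icc ((1 : ℝ) / 2 ^ k) (2 ^ k) →
      |x - y| ≤ 1 / 2 ^ μ (k, n) → |f x - f y| ≤ 1 / 2 ^ n

/-! Clear denominators in a putative relation and let γ^K g^L be its lexicographically largest
monomial; multiplying by g, and by γ if needed, makes K, L ≥ 1. Expanding gives Σ h(n) β^(-n) = 0
with h(n) in ℤ[β] of polynomial growth. The remainder Y_R = Σ_{n>R} h(n) β^(R-n) is then an integer
polynomial in β. As the other conjugates lie in the closed unit disc, a nonzero Y_R is at least a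
negative power of R (`exists_liouville_exponent`). So, for R ≤ 4N, Y_R ≠ 0 forces some h(n) ≠ 0 with
R < n ≤ R + N^e, up to rounding; conversely Y_R > 0 if the coefficients after R stay nonnegative
until well past a positive one (`exists_nonvanishing_set`).

These two facts conflict. Fewer than about N^(K/ρ+2e) values of R can have Y_R ≠ 0, because there
are at most N^(K/ρ+e) exponents below 4N. The exponents of monomials with γ-degree below K are rarer
still, so they miss a block of length about N^(1-(K-1)/ρ-2e). Greedy approximation
(`exists_mem_suppSet_pow_near`) puts an exponent of γ^K g^(L-1) near the start of that block. From
the last exponent of some γ^K g^l with l < L, adding an exponent of g must reach one of γ^K g^L, and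
these have positive coefficients; condition (3) on g then makes Y_R ≠ 0 too often
(`block_length_le`).

The greedy step needs ρ > K(K-1)/2 and the count needs ρ > 2K-1. Both follow from ρ > A²/2 when A ≥
4, so the constant function A₀ = 4 suffices. -/

open Filter Topology
open scoped Pointwise

/-! ### Arithmetic in ℚ(β): Liouville inequality and denominators. -/

open IntermediateField in
/-- A Liouville-type inequality: values at `β` of integer polynomials cannot be too small when the
other conjugates of `β` lie in the closed unit disc. -/
theorem exists_liouville_exponent {β : ℝ} (hβ : IsIntegral ℤ β)
    (hconj : ∀ z : ℂ, Polynomial.aeval z (minpoly ℚ β) = 0 → z ≠ (β : ℂ) → ‖z‖ ≤ 1) :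
    ∃ d : ℕ, ∀ (q : Polynomial ℤ) (M : ℝ), 1 ≤ M →
      (∀ z : ℂ, ‖z‖ ≤ 1 → ‖Polynomial.aeval z q‖ ≤ M) →
      Polynomial.aeval β q ≠ 0 → 1 ≤ |Polynomial.aeval β q| * M ^ d := by
  classical
  have hβQ : IsIntegral ℚ β := hβ.tower_top
  have : FiniteDimensional ℚ ℚ⟮β⟯ := adjoin.finiteDimensional hβQ
  refine ⟨Fintype.card (ℚ⟮β⟯ →ₐ[ℚ] ℂ), fun q M hM hq h0 => ?_⟩
  set x : ℚ⟮β⟯ := Polynomial.aeval (AdjoinSimple.gen ℚ β) q with hx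
  have hgenint : IsIntegral ℤ (AdjoinSimple.gen ℚ β) := by
    rw [← isIntegral_algebraMap_iff (A := ℚ⟮β⟯) (B := ℝ) (algebraMap ℚ⟮β⟯ ℝ).injective]
    simpa using hβ
  have hxβ : algebraMap ℚ⟮β⟯ ℝ x = Polynomial.aeval β q := by
    rw [hx, ← Polynomial.aeval_algebraMap_apply]
    simp
  have hxint : IsIntegral ℤ x := by
    rw [hx, Polynomial.aeval_eq_sum_range]
    exact IsIntegral.sum _ fun i _ => (hgenint.pow i).smul _
  have hx0 : x ≠ 0 := by
    rintro h
    rw [h, map_zero] at hxβ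
    exact h0 hxβ.symm
  obtain ⟨n, hn⟩ := IsIntegrallyClosed.isIntegral_iff.mp (Algebra.isIntegral_norm ℚ hxint)
  have hn0 : n ≠ 0 := by
    rintro rfl
    rw [map_zero] at hn
    exact hx0 (Algebra.norm_eq_zero_iff.mp hn.symm)
  have hprod := Algebra.norm_eq_prod_embeddings ℚ ℂ x
  -- The norm of a nonzero algebraic integer is a nonzero rational integer.
  have hnorm : (1 : ℝ) ≤ ∏ σ : ℚ⟮β⟯ →ₐ[ℚ] ℂ, ‖σ x‖ := by
    rw [← norm_prod, ← hprod, ← hn]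
    simp only [eq_intCast, map_intCast]
    rw [Complex.norm_intCast]
    exact_mod_cast Int.one_le_abs hn0
  let σ₀ : ℚ⟮β⟯ →ₐ[ℚ] ℂ := (Complex.ofRealAm.restrictScalars ℚ).comp (val ℚ⟮β⟯)
  have hσ₀ : ‖σ₀ x‖ = |Polynomial.aeval β q| := by
    have : σ₀ x = ((algebraMap ℚ⟮β⟯ ℝ x : ℝ) : ℂ) := rfl
    rw [this, hxβ, Complex.norm_real, Real.norm_eq_abs]
  have hσ : ∀ σ : ℚ⟮β⟯ →ₐ[ℚ] ℂ, σ ≠ σ₀ → ‖σ x‖ ≤ M := by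
    intro σ hne
    have h1 : σ x = Polynomial.aeval (σ (AdjoinSimple.gen ℚ β)) q := by
      rw [hx]
      exact (Polynomial.aeval_algHom_apply (σ.restrictScalars ℤ) _ q).symm
    rw [h1]
    refine hq _ (hconj _ ?_ ?_)
    · rw [Polynomial.aeval_algHom_apply]
      exact (congrArg σ (aeval_gen_minpoly ℚ β)).trans (map_zero σ)
    · intro h
      refine hne (algHom_ext_of_eq_adjoin ℚ (S := ℚ⟮β⟯) (s := {β}) rfl ?_)
      rintro s rfl
      exact h
  rw [← Finset.mul_prod_erase Finset.univ _ (Finset.mem_univ σ₀), hσ₀] at hnorm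
  refine hnorm.trans (mul_le_mul_of_nonneg_left ?_ (abs_nonneg _))
  calc ∏ σ ∈ Finset.univ.erase σ₀, ‖σ x‖ ≤ ∏ _σ ∈ Finset.univ.erase σ₀, M :=
        Finset.prod_le_prod (fun _ _ => norm_nonneg _) fun σ h => hσ σ (Finset.ne_of_mem_erase h)
    _ = M ^ (Finset.univ.erase σ₀).card := by rw [Finset.prod_const]
    _ ≤ _ := pow_le_pow_right₀ hM (Finset.card_le_univ _)

open IntermediateField in
/-- Finitely many elements of `ℚ(β)` have a common denominator over `ℤ[β]`. -/
theorem exists_common_denominator {β : ℝ} (hβ : IsIntegral ℚ β) {ι : Type*} [DecidableEq ι]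
    (s : Finset ι) (c : ι → ℚ⟮β⟯) :
    ∃ b : ℤ, b ≠ 0 ∧ ∀ i ∈ s, ∃ p : Polynomial ℤ, Polynomial.aeval β p = b * (c i : ℝ) := by
  have single : ∀ y : ℚ⟮β⟯, ∃ b : ℤ, b ≠ 0 ∧ ∃ p : Polynomial ℤ,
      Polynomial.aeval β p = b * (y : ℝ) := by
    intro y
    have hy : (y : ℝ) ∈ Algebra.adjoin ℚ {β} := by
      rw [← adjoin_simple_toSubalgebra_of_isAlgebraic hβ.isAlgebraic]
      exact y.2
    rw [Algebra.adjoin_singleton_eq_range_aeval] at hy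
    obtain ⟨p, hp⟩ := hy
    obtain ⟨b, hb0, hb⟩ := IsLocalization.integerNormalization_spec (nonZeroDivisors ℤ) p
    refine ⟨b, nonZeroDivisors.ne_zero hb0,
      IsLocalization.integerNormalization (nonZeroDivisors ℤ) p, ?_⟩
    rw [← Polynomial.aeval_map_algebraMap ℚ, hb, ← hp]
    simp
  induction s using Finset.induction_on with
  | empty => exact ⟨1, one_ne_zero, by simp⟩
  | insert i s _ ih =>
    obtain ⟨b, hb, h⟩ := ih
    obtain ⟨b', hb', p', hp'⟩ := single (c i)
    refine ⟨b * b', mul_ne_zero hb hb', fun j hj => ?_⟩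
    rcases Finset.mem_insert.mp hj with rfl | hj
    · exact ⟨Polynomial.C b * p', by simp [hp', mul_assoc]⟩
    · obtain ⟨p, hp⟩ := h j hj
      exact ⟨Polynomial.C b' * p, by simp [hp]; ring⟩

/-! ### Supports, growth and values of power series over ℕ. -/

theorem mem_suppSet {g : PowerSeries ℕ} {n : ℕ} : n ∈ suppSet g ↔ PowerSeries.coeff n g ≠ 0 :=
  Iff.rfl

/-- Coefficients in ℕ cannot cancel, so supports multiply exactly as sumsets. All signs are kept in
the polynomials in β that multiply these series. -/
theorem mem_suppSet_mul {f g : PowerSeries ℕ} {n : ℕ} :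
    n ∈ suppSet (f * g) ↔ ∃ a ∈ suppSet f, ∃ b ∈ suppSet g, a + b = n := by
  simp only [mem_suppSet, PowerSeries.coeff_mul, ne_eq, Finset.sum_eq_zero_iff, not_forall,
    Finset.HasAntidiagonal.mem_antidiagonal, mul_eq_zero, not_or, Prod.exists]
  constructor
  · rintro ⟨a, b, hab, ha, hb⟩
    exact ⟨a, ha, b, hb, hab⟩
  · rintro ⟨a, ha, b, hb, hab⟩
    exact ⟨a, b, hab, ha, hb⟩

theorem add_mem_suppSet_mul {f g : PowerSeries ℕ} {a b : ℕ} (ha : a ∈ suppSet f)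
    (hb : b ∈ suppSet g) : a + b ∈ suppSet (f * g) :=
  mem_suppSet_mul.2 ⟨a, ha, b, hb, rfl⟩

theorem zero_mem_suppSet_one : 0 ∈ suppSet 1 := by simp [mem_suppSet]

theorem mul_mem_suppSet_pow {g : PowerSeries ℕ} {a : ℕ} (ha : a ∈ suppSet g) (l : ℕ) :
    l * a ∈ suppSet (g ^ l) := by
  induction l with
  | zero => simpa using zero_mem_suppSet_one
  | succ l ih =>
    rw [pow_succ, add_mul, one_mul]
    exact add_mem_suppSet_mul ih ha

theorem finite_inter_lt (𝒜 : Set ℕ) (R : ℝ) : {n : ℕ | n ∈ 𝒜 ∧ (n : ℝ) < R}.Finite :=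
  (Set.finite_Iio ⌈R⌉₊).subset fun _ hn => Set.mem_Iio.2 (Nat.lt_ceil.2 hn.2)

theorem countBelow_suppSet_mul (f g : PowerSeries ℕ) (R : ℝ) :
    countBelow (suppSet (f * g)) R ≤ countBelow (suppSet f) R * countBelow (suppSet g) R := by
  have hsub : {n : ℕ | n ∈ suppSet (f * g) ∧ (n : ℝ) < R} ⊆
      {n : ℕ | n ∈ suppSet f ∧ (n : ℝ) < R} + {n : ℕ | n ∈ suppSet g ∧ (n : ℝ) < R} := by
    rintro n ⟨hn, hR⟩
    obtain ⟨a, ha, b, hb, rfl⟩ := mem_suppSet_mul.1 hn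
    push_cast at hR
    have ha0 : (0 : ℝ) ≤ a := a.cast_nonneg
    have hb0 : (0 : ℝ) ≤ b := b.cast_nonneg
    exact Set.add_mem_add ⟨ha, by linarith⟩ ⟨hb, by linarith⟩
  unfold countBelow
  refine (Set.ncard_le_ncard hsub ((finite_inter_lt _ _).add (finite_inter_lt _ _))).trans ?_
  rw [← Nat.card_coe_set_eq, ← Nat.card_coe_set_eq, ← Nat.card_coe_set_eq]
  exact Set.natCard_add_le

theorem countBelow_suppSet_one (R : ℝ) : countBelow (suppSet 1) R ≤ 1 := by
  unfold countBelow
  refine (Set.ncard_le_ncard (t := {0}) ?_).trans (Set.ncard_singleton 0).le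
  rintro n ⟨hn, -⟩
  by_contra h
  exact hn (by simpa [PowerSeries.coeff_one] using h)

theorem countBelow_suppSet_pow (f : PowerSeries ℕ) (k : ℕ) (R : ℝ) :
    countBelow (suppSet (f ^ k)) R ≤ countBelow (suppSet f) R ^ k := by
  induction k with
  | zero => simpa using countBelow_suppSet_one R
  | succ k ih =>
    rw [pow_succ, pow_succ]
    exact (countBelow_suppSet_mul _ _ _).trans (Nat.mul_le_mul_right _ ih)

/-- The coefficients of `g` grow at most polynomially. -/
def PolyBounded (g : PowerSeries ℕ) : Prop :=
  ∃ B D : ℕ, ∀ n, PowerSeries.coeff n g ≤ B * (n + 1) ^ D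

theorem PolyBounded.one : PolyBounded 1 :=
  ⟨1, 0, fun n => by rw [PowerSeries.coeff_one]; split_ifs <;> simp⟩

theorem PolyBounded.mul {f g : PowerSeries ℕ} (hf : PolyBounded f) (hg : PolyBounded g) :
    PolyBounded (f * g) := by
  obtain ⟨B, D, h⟩ := hf
  obtain ⟨B', D', h'⟩ := hg
  refine ⟨B * B', D + D' + 1, fun n => ?_⟩
  rw [PowerSeries.coeff_mul]
  calc ∑ p ∈ Finset.HasAntidiagonal.antidiagonal n, PowerSeries.coeff p.1 f * PowerSeries.coeff p.2 g
      ≤ ∑ _p ∈ Finset.HasAntidiagonal.antidiagonal n, (B * (n + 1) ^ D) * (B' * (n + 1) ^ D') := by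
        refine Finset.sum_le_sum fun p hp => Nat.mul_le_mul ?_ ?_
        · refine (h _).trans ?_
          gcongr
          have := Finset.HasAntidiagonal.mem_antidiagonal.1 hp
          omega
        · refine (h' _).trans ?_
          gcongr
          have := Finset.HasAntidiagonal.mem_antidiagonal.1 hp
          omega
    _ = B * B' * (n + 1) ^ (D + D' + 1) := by
        rw [Finset.sum_const, Finset.Nat.card_antidiagonal, smul_eq_mul]
        ring

theorem PolyBounded.pow {f : PowerSeries ℕ} (hf : PolyBounded f) (k : ℕ) :
    PolyBounded (f ^ k) := by
  induction k with
  | zero => simpa using PolyBounded.one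
  | succ k ih => rw [pow_succ]; exact ih.mul hf

theorem summable_succ_pow_mul_geometric (D : ℕ) {x : ℝ} (hx0 : 0 ≤ x) (hx1 : x < 1) :
    Summable fun n : ℕ => ((n : ℝ) + 1) ^ D * x ^ n := by
  rcases hx0.eq_or_lt with rfl | hx
  · refine summable_of_ne_finset_zero (s := {0}) fun n hn => ?_
    simp only [Finset.mem_singleton] at hn
    simp [hn]
  have h := (summable_nat_add_iff 1).2
    (summable_pow_mul_geometric_of_norm_lt_one (R := ℝ) D (r := x) (by
      rwa [Real.norm_of_nonneg hx0]))
  refine (h.mul_left x⁻¹).congr fun n => ?_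
  push_cast
  field_simp
  ring

theorem PolyBounded.summable {g : PowerSeries ℕ} (hg : PolyBounded g) {x : ℝ} (hx0 : 0 ≤ x)
    (hx1 : x < 1) : Summable fun n : ℕ => ((PowerSeries.coeff n g : ℕ) : ℝ) * x ^ n := by
  obtain ⟨B, D, h⟩ := hg
  refine Summable.of_nonneg_of_le (fun n => by positivity) (fun n => ?_)
    ((summable_succ_pow_mul_geometric D hx0 hx1).mul_left (B : ℝ))
  rw [← mul_assoc]
  gcongr
  exact_mod_cast h n

theorem seriesValue_one (x : ℝ) : seriesValue 1 x = 1 := by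
  unfold seriesValue
  rw [tsum_eq_single 0 (fun n hn => by simp [PowerSeries.coeff_one, hn])]
  simp

theorem seriesValue_mul {f g : PowerSeries ℕ} (hf : PolyBounded f) (hg : PolyBounded g) {x : ℝ}
    (hx0 : 0 ≤ x) (hx1 : x < 1) :
    seriesValue (f * g) x = seriesValue f x * seriesValue g x := by
  unfold seriesValue
  rw [tsum_mul_tsum_eq_tsum_sum_antidiagonal_of_summable_norm (hf.summable hx0 hx1).norm
    (hg.summable hx0 hx1).norm]
  refine tsum_congr fun n => ?_
  rw [PowerSeries.coeff_mul]
  push_cast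
  rw [Finset.sum_mul]
  refine Finset.sum_congr rfl fun p hp => ?_
  rw [← Finset.HasAntidiagonal.mem_antidiagonal.1 hp, pow_add]
  ring

theorem seriesValue_pow {f : PowerSeries ℕ} (hf : PolyBounded f) {x : ℝ}
    (hx0 : 0 ≤ x) (hx1 : x < 1) (k : ℕ) : seriesValue (f ^ k) x = seriesValue f x ^ k := by
  induction k with
  | zero => simp [seriesValue_one]
  | succ k ih => rw [pow_succ, seriesValue_mul (hf.pow k) hf hx0 hx1, ih, pow_succ]

/-! ### The power series of γ. -/

/-- The power series with coefficients `0` and `1` whose exponents are the `⌊m ^ ρ⌋`. -/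
noncomputable def floorPowSeries (ρ : ℝ) : PowerSeries ℕ :=
  PowerSeries.mk ((Set.range fun m : ℕ => ⌊(m : ℝ) ^ ρ⌋₊).indicator 1)

theorem suppSet_floorPowSeries (ρ : ℝ) :
    suppSet (floorPowSeries ρ) = Set.range fun m : ℕ => ⌊(m : ℝ) ^ ρ⌋₊ := by
  ext n
  rw [mem_suppSet, floorPowSeries, PowerSeries.coeff_mk]
  by_cases h : n ∈ Set.range fun m : ℕ => ⌊(m : ℝ) ^ ρ⌋₊ <;> simp [Set.indicator, h]

theorem floorPowSeries_polyBounded (ρ : ℝ) : PolyBounded (floorPowSeries ρ) := by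
  refine ⟨1, 0, fun n => ?_⟩
  rw [floorPowSeries, PowerSeries.coeff_mk]
  simpa using Set.indicator_le_self' (f := (1 : ℕ → ℕ)) (fun _ _ => zero_le) n

/-- For ρ ≥ 1 consecutive powers differ by at least 1. Hence no exponent of γ repeats, and 0-1
coefficients are the right ones. -/
theorem floor_rpow_injective {ρ : ℝ} (hρ : 1 ≤ ρ) :
    Function.Injective fun m : ℕ => ⌊(m : ℝ) ^ ρ⌋₊ := by
  refine (strictMono_nat_of_lt_succ fun m => ?_).injective
  rw [Nat.lt_iff_add_one_le]
  refine Nat.le_floor ?_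
  have h1 := Real.add_rpow_le_rpow_add (a := (m : ℝ)) (b := 1) (by positivity) zero_le_one hρ
  rw [Real.one_rpow] at h1
  push_cast
  have := Nat.floor_le (a := (m : ℝ) ^ ρ) (by positivity)
  linarith

theorem seriesValue_floorPowSeries {ρ : ℝ} (hρ : 1 ≤ ρ) (x : ℝ) :
    seriesValue (floorPowSeries ρ) x = gammaSeries ρ x := by
  unfold seriesValue gammaSeries
  have hinj := floor_rpow_injective hρ
  rw [← hinj.tsum_eq (f := fun n => ((PowerSeries.coeff n (floorPowSeries ρ) : ℕ) : ℝ) * x ^ n)]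
  · refine tsum_congr fun m => ?_
    rw [floorPowSeries, PowerSeries.coeff_mk, Set.indicator_of_mem (Set.mem_range_self m)]
    simp
  · intro n hn
    rw [← suppSet_floorPowSeries]
    intro h
    exact hn (by simp [h])

/-! ### Scaled remainders and their vanishing. -/

/-- The scaled remainder `∑_{n > R} h n * x ^ (n - R)` of the series `∑ h n * x ^ n`. -/
noncomputable def scaledTail (h : ℕ → ℝ) (x : ℝ) (R : ℕ) : ℝ :=
  ∑' m : ℕ, h (R + 1 + m) * x ^ (m + 1)

theorem summable_of_polyGrowth {h : ℕ → ℝ} {B D : ℕ} (hh : ∀ n, |h n| ≤ B * ((n : ℝ) + 1) ^ D)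
    {x : ℝ} (hx0 : 0 ≤ x) (hx1 : x < 1) : Summable fun n : ℕ => h n * x ^ n := by
  refine Summable.of_norm_bounded
    ((summable_succ_pow_mul_geometric D hx0 hx1).mul_left (B : ℝ)) fun n => ?_
  rw [norm_mul, norm_pow, Real.norm_eq_abs, Real.norm_of_nonneg hx0, ← mul_assoc]
  gcongr
  exact hh n

theorem scaledTail_mul_pow (h : ℕ → ℝ) (x : ℝ) (R : ℕ) :
    scaledTail h x R * x ^ R = ∑' m : ℕ, h (m + (R + 1)) * x ^ (m + (R + 1)) := by
  rw [scaledTail, ← tsum_mul_right]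
  refine tsum_congr fun m => ?_
  rw [show R + 1 + m = m + (R + 1) by ring, show m + (R + 1) = (m + 1) + R by ring, pow_add _ (m + 1)]
  ring

theorem scaledTail_eq_sum_add {h : ℕ → ℝ} {x : ℝ} (hx : x ≠ 0)
    (hs : Summable fun n : ℕ => h n * x ^ n) (R d : ℕ) :
    scaledTail h x R =
      ∑ m ∈ Finset.range d, h (R + 1 + m) * x ^ (m + 1) + x ^ d * scaledTail h x (R + d) := by
  have hs' : Summable fun m : ℕ => h (R + 1 + m) * x ^ (m + 1) := by
    refine (((summable_nat_add_iff (R + 1)).2 hs).mul_right (x ^ R)⁻¹).congr fun m => ?_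
    have : x ^ R ≠ 0 := pow_ne_zero _ hx
    rw [show R + 1 + m = m + (R + 1) by ring, show x ^ (m + (R + 1)) = x ^ (m + 1) * x ^ R by ring]
    field_simp
  rw [scaledTail, ← hs'.sum_add_tsum_nat_add d, scaledTail, ← tsum_mul_left]
  congr 1
  refine tsum_congr fun m => ?_
  rw [show R + 1 + (m + d) = R + d + 1 + m by ring]
  ring

/-- The nonnegative terms up to `R + w` can be dropped. Beyond them x^(m+1) ≤ √x^w √x^m: one half of
the exponent gives the decay, the other the convergence. Applied to `h` and `-h`, this bounds the
remainder on both sides before a gap. -/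
theorem exists_scaledTail_lower_bound (B D : ℕ) {x : ℝ} (hx0 : 0 < x) (hx1 : x < 1) :
    ∃ M : ℝ, 0 ≤ M ∧ ∀ (h : ℕ → ℝ), (∀ n, |h n| ≤ B * ((n : ℝ) + 1) ^ D) →
      ∀ R w : ℕ, (∀ n, R < n → n ≤ R + w → 0 ≤ h n) →
        -(M * ((R : ℝ) + 1) ^ D * √x ^ w) ≤ scaledTail h x R := by
  have hκ0 : 0 ≤ √x := Real.sqrt_nonneg x
  have hκ1 : √x < 1 := by rwa [Real.sqrt_lt' one_pos, one_pow]
  have hκ : √x ^ 2 = x := Real.sq_sqrt hx0.le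
  have hS := summable_succ_pow_mul_geometric D hκ0 hκ1
  refine ⟨B * 2 ^ D * ∑' n : ℕ, ((n : ℝ) + 1) ^ D * √x ^ n,
    mul_nonneg (by positivity) (tsum_nonneg fun n => by positivity), fun h hh R w hpos => ?_⟩
  have hb : ∀ m : ℕ, |h (R + 1 + m)| ≤ B * 2 ^ D * ((R : ℝ) + 1) ^ D * ((m : ℝ) + 1) ^ D := by
    intro m
    refine (hh _).trans ?_
    rw [mul_assoc, mul_assoc, ← mul_pow, ← mul_pow]
    have hm : (0 : ℝ) ≤ m := m.cast_nonneg
    have hR : (0 : ℝ) ≤ R := R.cast_nonneg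
    gcongr
    -- The bound R + m + 2 ≤ 2 (R + 1) (m + 1) separates `R` from `m`.
    push_cast
    nlinarith [mul_nonneg hR hm]
  have hs : Summable fun m : ℕ => h (R + 1 + m) * x ^ (m + 1) := by
    refine Summable.of_norm_bounded (g := fun m : ℕ =>
      B * 2 ^ D * ((R : ℝ) + 1) ^ D * (((m : ℝ) + 1) ^ D * √x ^ m)) (hS.mul_left _) fun m => ?_
    rw [norm_mul, Real.norm_eq_abs, Real.norm_of_nonneg (by positivity), ← mul_assoc]
    refine mul_le_mul (hb m) ?_ (by positivity) (by positivity)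
    rw [← hκ, ← pow_mul, hκ]
    exact pow_le_pow_of_le_one hκ0 hκ1.le (by omega)
  have heq : -(B * 2 ^ D * (∑' n : ℕ, ((n : ℝ) + 1) ^ D * √x ^ n) * ((R : ℝ) + 1) ^ D * √x ^ w) =
      ∑' m : ℕ, -(B * 2 ^ D * ((R : ℝ) + 1) ^ D * √x ^ w) * (((m : ℝ) + 1) ^ D * √x ^ m) := by
    rw [tsum_mul_left]
    ring
  rw [heq, scaledTail]
  refine (hS.mul_left _).tsum_le_tsum (fun m => ?_) hs
  rcases lt_or_ge m w with hm | hm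
  · have h1 : 0 ≤ h (R + 1 + m) * x ^ (m + 1) :=
      mul_nonneg (hpos _ (by omega) (by omega)) (by positivity)
    refine le_trans ?_ h1
    rw [neg_mul]
    exact neg_nonpos.2 (by positivity)
  · have h2 : x ^ (m + 1) ≤ √x ^ w * √x ^ m := by
      rw [← pow_add, ← hκ, ← pow_mul, hκ]
      exact pow_le_pow_of_le_one hκ0 hκ1.le (by omega)
    have h3 : |h (R + 1 + m) * x ^ (m + 1)| ≤
        B * 2 ^ D * ((R : ℝ) + 1) ^ D * ((m : ℝ) + 1) ^ D * (√x ^ w * √x ^ m) := by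
      rw [abs_mul, abs_of_pos (pow_pos hx0 (m + 1))]
      exact mul_le_mul (hb m) h2 (by positivity) (by positivity)
    have h4 := neg_le_of_abs_le h3
    linarith

theorem eventually_mul_pow_ceil_rpow_lt {κ e c : ℝ} (hκ0 : 0 < κ) (hκ1 : κ < 1) (he : 0 < e)
    (hc : 0 < c) (a : ℝ) (P : ℕ) :
    ∀ᶠ N : ℕ in atTop, a * (4 * (N : ℝ) + 1) ^ P * κ ^ ⌈(N : ℝ) ^ e⌉₊ < c := by
  have hb : 0 < -Real.log κ := neg_pos.2 (Real.log_neg hκ0 hκ1)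
  have h1 := (isLittleO_rpow_exp_pos_mul_atTop ((P : ℝ) / e) hb).comp_tendsto
    ((tendsto_rpow_atTop he).comp tendsto_natCast_atTop_atTop)
  have hpos : 0 < c / (|a| * 5 ^ P + 1) := by positivity
  filter_upwards [h1.def hpos, eventually_ge_atTop 1] with N hN hN1
  have hN1' : (1 : ℝ) ≤ N := by exact_mod_cast hN1
  simp only [Function.comp] at hN
  rw [← Real.rpow_mul (by positivity), mul_div_cancel₀ _ he.ne', Real.rpow_natCast,
    Real.norm_of_nonneg (by positivity), Real.norm_of_nonneg (Real.exp_pos _).le] at hN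
  have h2 : κ ^ ⌈(N : ℝ) ^ e⌉₊ ≤ (Real.exp (-Real.log κ * (N : ℝ) ^ e))⁻¹ := by
    rw [← Real.exp_neg, ← neg_mul, neg_neg, ← Real.rpow_def_of_pos hκ0, ← Real.rpow_natCast]
    exact Real.rpow_le_rpow_of_exponent_ge hκ0 hκ1.le (Nat.le_ceil _)
  have hE := Real.exp_pos (-Real.log κ * (N : ℝ) ^ e)
  set E := Real.exp (-Real.log κ * (N : ℝ) ^ e)
  calc a * (4 * (N : ℝ) + 1) ^ P * κ ^ ⌈(N : ℝ) ^ e⌉₊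
      ≤ |a| * (5 * (N : ℝ)) ^ P * E⁻¹ := by
        gcongr
        · exact le_abs_self a
        · linarith
    _ ≤ |a| * 5 ^ P * (c / (|a| * 5 ^ P + 1) * E) * E⁻¹ := by
        rw [mul_pow, ← mul_assoc]
        gcongr
    _ = (|a| * 5 ^ P) / (|a| * 5 ^ P + 1) * c := by field_simp
    _ < 1 * c := by
        gcongr
        rw [div_lt_one (by positivity)]
        linarith
    _ = c := one_mul c

/-- If a series with coefficients in `ℤ[β]` of polynomial growth vanishes at `β⁻¹`, then its scaled
remainders vanish before long gaps and do not vanish before a positive coefficient that is followed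
by a long stretch of nonnegative ones. -/
theorem exists_nonvanishing_set {β : ℝ} (hβ : IsIntegral ℤ β) (hβ1 : 1 < β)
    (hconj : ∀ z : ℂ, Polynomial.aeval z (minpoly ℚ β) = 0 → z ≠ (β : ℂ) → ‖z‖ ≤ 1)
    (H : ℕ → Polynomial ℤ) (B D : ℕ)
    (hdisc : ∀ n (z : ℂ), ‖z‖ ≤ 1 → ‖Polynomial.aeval z (H n)‖ ≤ B * ((n : ℝ) + 1) ^ D)
    (hreal : ∀ n, |Polynomial.aeval β (H n)| ≤ B * ((n : ℝ) + 1) ^ D)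
    (hzero : ∑' n, Polynomial.aeval β (H n) * β⁻¹ ^ n = 0) {e c : ℝ} (he : 0 < e) (hc : 0 < c) :
    ∃ Z : ℕ → Prop, ∀ᶠ N : ℕ in atTop, ∀ R ≤ 4 * N,
      (Z R → ∃ n, R < n ∧ n ≤ R + ⌈(N : ℝ) ^ e⌉₊ ∧ Polynomial.aeval β (H n) ≠ 0) ∧
      ∀ θ ≤ 4 * N, R < θ →
        (∀ n, R < n → n ≤ θ + ⌈(N : ℝ) ^ e⌉₊ → 0 ≤ Polynomial.aeval β (H n)) →
        c ≤ Polynomial.aeval β (H θ) → Z R := by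
  set h : ℕ → ℝ := fun n => Polynomial.aeval β (H n) with hh
  set x := β⁻¹ with hx
  have hβ0 : 0 < β := one_pos.trans hβ1
  have hx0 : 0 < x := inv_pos.2 hβ0
  have hx1 : x < 1 := inv_lt_one_of_one_lt₀ hβ1
  have hκ0 : 0 < √x := Real.sqrt_pos.2 hx0
  have hκ1 : √x < 1 := by rwa [Real.sqrt_lt' one_pos, one_pow]
  have hs := summable_of_polyGrowth hreal hx0.le hx1
  obtain ⟨M, hM0, hM⟩ := exists_scaledTail_lower_bound B D hx0 hx1
  obtain ⟨d, hd⟩ := exists_liouville_exponent hβ hconj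
  -- The full series vanishes, so β^R times its partial sum is minus the scaled remainder.
  have hYpoly : ∀ R, Polynomial.aeval β
      (∑ n ∈ Finset.range (R + 1), H n * Polynomial.X ^ (R - n)) = -scaledTail h x R := by
    intro R
    have h1 := scaledTail_mul_pow h x R
    have h2 := hs.sum_add_tsum_nat_add (R + 1)
    rw [hzero, ← h1] at h2
    have hxR : x ^ R ≠ 0 := (pow_pos hx0 R).ne'
    refine mul_right_cancel₀ hxR ?_
    rw [neg_mul, ← eq_neg_of_add_eq_zero_left h2, map_sum, Finset.sum_mul]
    refine Finset.sum_congr rfl fun n hn => ?_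
    have hnR : n ≤ R := Nat.lt_succ_iff.1 (Finset.mem_range.1 hn)
    rw [map_mul, map_pow, Polynomial.aeval_X, mul_assoc]
    congr 1
    obtain ⟨j, rfl⟩ := Nat.exists_eq_add_of_le hnR
    rw [Nat.add_sub_cancel_left, pow_add, mul_left_comm, ← mul_pow, hx,
      mul_inv_cancel₀ hβ0.ne', one_pow, mul_one]
  have hYdisc : ∀ R (z : ℂ), ‖z‖ ≤ 1 → ‖Polynomial.aeval z
      (∑ n ∈ Finset.range (R + 1), H n * Polynomial.X ^ (R - n))‖ ≤
        (B + 1) * ((R : ℝ) + 1) ^ (D + 1) := by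
    intro R z hz
    rw [map_sum]
    refine (norm_sum_le _ _).trans ?_
    calc _ ≤ ∑ _n ∈ Finset.range (R + 1), (B + 1) * ((R : ℝ) + 1) ^ D := by
          refine Finset.sum_le_sum fun n hn => ?_
          have hnR : (n : ℝ) ≤ R := by exact_mod_cast Nat.lt_succ_iff.1 (Finset.mem_range.1 hn)
          rw [map_mul, map_pow, Polynomial.aeval_X, norm_mul, norm_pow]
          calc _ ≤ (B * ((n : ℝ) + 1) ^ D) * 1 :=
                mul_le_mul (hdisc n z hz) (pow_le_one₀ (norm_nonneg z) hz) (by positivity)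
                  (by positivity)
            _ ≤ _ := by
                rw [mul_one]
                gcongr
                linarith
      _ = _ := by
          rw [Finset.sum_const, Finset.card_range, nsmul_eq_mul]
          push_cast
          ring
  refine ⟨fun R => scaledTail h x R ≠ 0, ?_⟩
  -- The first bound keeps the negative mass after θ below `c`; the second brings a remainder before
  -- a gap below the Liouville bound.
  filter_upwards [eventually_mul_pow_ceil_rpow_lt hκ0 hκ1 he hc M D,
    eventually_mul_pow_ceil_rpow_lt hκ0 hκ1 he one_pos (M * (B + 1) ^ d) (D + (D + 1) * d)]
    with N hN1 hN2 R hR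
  set w := ⌈(N : ℝ) ^ e⌉₊
  have hR' : (R : ℝ) ≤ 4 * N := by exact_mod_cast hR
  constructor
  · intro hY
    by_contra! hcon
    have hlow := hM h hreal R w fun n h1 h2 => (hcon n h1 h2).ge
    have hup := hM (fun n => -h n) (fun n => by rw [abs_neg]; exact hreal n) R w
      fun n h1 h2 => by simp only [Left.nonneg_neg_iff]; exact (hcon n h1 h2).le
    have hneg : scaledTail (fun n => -h n) x R = -scaledTail h x R := by
      simp only [scaledTail, neg_mul, tsum_neg]
    rw [hneg, neg_le_neg_iff] at hup
    have habs := abs_le.2 ⟨hlow, hup⟩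
    have hlio := hd _ ((B + 1) * ((R : ℝ) + 1) ^ (D + 1))
      (by
        have h1 : (1 : ℝ) ≤ ((R : ℝ) + 1) ^ (D + 1) :=
          one_le_pow₀ (by linarith [(R.cast_nonneg : (0 : ℝ) ≤ R)])
        nlinarith [(B.cast_nonneg : (0 : ℝ) ≤ B)])
      (hYdisc R) (by rw [hYpoly]; exact neg_ne_zero.2 hY)
    rw [hYpoly, abs_neg] at hlio
    have : |scaledTail h x R| * ((B + 1) * ((R : ℝ) + 1) ^ (D + 1)) ^ d < 1 := by
      calc _ ≤ (M * (4 * (N : ℝ) + 1) ^ D * √x ^ w) *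
            ((B + 1) * (4 * (N : ℝ) + 1) ^ (D + 1)) ^ d := by
            refine mul_le_mul (habs.trans ?_) ?_ (by positivity) (by positivity) <;> gcongr
        _ = M * (B + 1) ^ d * (4 * (N : ℝ) + 1) ^ (D + (D + 1) * d) * √x ^ w := by
            rw [mul_pow, ← pow_mul, pow_add]
            ring
        _ < 1 := hN2
    linarith
  · intro θ hθ hRθ hpos hcθ
    have hθ' : (θ : ℝ) ≤ 4 * N := by exact_mod_cast hθ
    obtain ⟨j, rfl⟩ := Nat.exists_eq_add_of_lt hRθ
    -- Splitting at θ, the terms up to θ give at least c x^(j+1) and the rest exceeds -c x^(j+1).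
    have hsplit := scaledTail_eq_sum_add hx0.ne' hs R (j + 1)
    have hlow := hM h hreal (R + j + 1) w fun n h1 h2 => hpos n (by omega) h2
    have hbd : M * (((R + j + 1 : ℕ) : ℝ) + 1) ^ D * √x ^ w < c := by
      refine lt_of_le_of_lt ?_ hN1
      gcongr
    have hsum : c * x ^ (j + 1) ≤ ∑ m ∈ Finset.range (j + 1), h (R + 1 + m) * x ^ (m + 1) := by
      rw [Finset.sum_range_succ]
      have h1 : 0 ≤ ∑ m ∈ Finset.range j, h (R + 1 + m) * x ^ (m + 1) :=
        Finset.sum_nonneg fun m hm => by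
          have := Finset.mem_range.1 hm
          exact mul_nonneg (hpos _ (by omega) (by omega)) (by positivity)
      have h2 : c * x ^ (j + 1) ≤ h (R + 1 + j) * x ^ (j + 1) := by
        rw [show R + 1 + j = R + j + 1 by ring]
        gcongr
      linarith
    rw [← add_assoc] at hsplit
    have hfin : 0 < scaledTail h x R := by
      rw [hsplit]
      have h3 : 0 < x ^ (j + 1) * (c + scaledTail h x (R + j + 1)) :=
        mul_pos (by positivity) (by linarith)
      linarith
    exact hfin.ne'

/-! ### Exponent inequalities and greedy approximation. -/

theorem one_sub_pow_le {r : ℝ} (h0 : 0 ≤ r) (h1 : r ≤ 1) (K : ℕ) :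
    (1 - r) ^ K ≤ 1 - K * r + K * (K - 1) / 2 * r ^ 2 := by
  induction K with
  | zero => simp
  | succ K ih =>
    have hK : (0 : ℝ) ≤ K * (K - 1) := by
      rcases K.eq_zero_or_pos with rfl | hK
      · simp
      · have : (1 : ℝ) ≤ K := by exact_mod_cast hK
        exact mul_nonneg (by linarith) (by linarith)
    have h2 := mul_le_mul_of_nonneg_right ih (sub_nonneg.2 h1)
    have h3 : 0 ≤ K * (K - 1) * r ^ 3 := mul_nonneg hK (by positivity)
    rw [pow_succ]
    push_cast
    nlinarith

/-- With r = 1/ρ, the second-order bound on (1-r)^K turns ρ > K(K-1)/2 into room for the greedy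
error inside the free block. The condition (2K-1) r < 1 makes that block longer than the counting
bound. -/
theorem exists_exponent_slack {ρ : ℝ} {K : ℕ} (hK : 1 ≤ K) (h1 : (K : ℝ) * (K - 1) / 2 < ρ)
    (h2 : 2 * (K : ℝ) - 1 < ρ) :
    ∃ e : ℝ, 0 < e ∧ e < 1 ∧ (1 - 1 / ρ) ^ K < 1 - (K - 1) * (1 / ρ) - 2 * e ∧
      K * (1 / ρ) + 2 * e < 1 - (K - 1) * (1 / ρ) - 2 * e := by
  have hK' : (1 : ℝ) ≤ K := by exact_mod_cast hK
  have hρ : 1 < ρ := by linarith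
  have hρ0 : 0 < ρ := by linarith
  set r := 1 / ρ with hr
  have hr0 : 0 < r := by positivity
  have hrρ : r * ρ = 1 := by rw [hr]; field_simp
  have hr1 : r ≤ 1 := by rw [hr, div_le_one hρ0]; exact hρ.le
  have hA : 0 < r - (K : ℝ) * (K - 1) / 2 * r ^ 2 := by
    have := mul_pos (mul_pos hr0 hr0) (sub_pos.2 h1)
    nlinarith
  have hB : 0 < 1 - (2 * (K : ℝ) - 1) * r := by
    have := mul_pos hr0 (sub_pos.2 h2)
    nlinarith
  have hpow := one_sub_pow_le hr0.le hr1 K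
  -- The slacks must exceed 2e and 4e respectively; dividing by 4 and 8 keeps this strict.
  refine ⟨min (1 / 2) (min ((r - (K : ℝ) * (K - 1) / 2 * r ^ 2) / 4)
    ((1 - (2 * (K : ℝ) - 1) * r) / 8)), ?_, ?_, ?_, ?_⟩
  · exact lt_min (by norm_num) (lt_min (by linarith) (by linarith))
  · exact (min_le_left _ _).trans_lt (by norm_num)
  · have := (min_le_right (1 / 2 : ℝ) _).trans (min_le_left
      ((r - (K : ℝ) * (K - 1) / 2 * r ^ 2) / 4) ((1 - (2 * (K : ℝ) - 1) * r) / 8))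
    linarith
  · have := (min_le_right (1 / 2 : ℝ) _).trans (min_le_right
      ((r - (K : ℝ) * (K - 1) / 2 * r ^ 2) / 4) ((1 - (2 * (K : ℝ) - 1) * r) / 8))
    linarith

/-- Consecutive ρ-th powers around x ≤ X are O(X^(1-1/ρ)) apart; the `+ 1` pays for the floor. -/
theorem exists_floor_rpow_near {ρ : ℝ} (hρ : 1 ≤ ρ) {x X : ℝ} (hx0 : 0 ≤ x) (hxX : x ≤ X)
    (hX : 1 ≤ X) : ∃ a ∈ suppSet (floorPowSeries ρ), (a : ℝ) ≤ x ∧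
      x - a ≤ (ρ * 2 ^ (ρ - 1) + 1) * X ^ (1 - 1 / ρ) := by
  have hρ0 : 0 < ρ := by linarith
  set m := ⌊x ^ (1 / ρ)⌋₊ with hm
  have hm1 : (m : ℝ) ^ ρ ≤ x := by
    have h := Nat.floor_le (a := x ^ (1 / ρ)) (by positivity)
    calc (m : ℝ) ^ ρ ≤ (x ^ (1 / ρ)) ^ ρ := by gcongr
      _ = x := by rw [← Real.rpow_mul hx0, one_div_mul_cancel hρ0.ne', Real.rpow_one]
  have hm2 : x ≤ ((m : ℝ) + 1) ^ ρ := by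
    have h := (Nat.lt_floor_add_one (x ^ (1 / ρ))).le
    calc x = (x ^ (1 / ρ)) ^ ρ := by
          rw [← Real.rpow_mul hx0, one_div_mul_cancel hρ0.ne', Real.rpow_one]
      _ ≤ _ := by gcongr
  have hm3 : (m : ℝ) + 1 ≤ 2 * X ^ (1 / ρ) := by
    have h := Nat.floor_le (a := x ^ (1 / ρ)) (by positivity)
    have h' : x ^ (1 / ρ) ≤ X ^ (1 / ρ) := by gcongr
    have h'' : 1 ≤ X ^ (1 / ρ) := Real.one_le_rpow hX (by positivity)
    linarith
  have hm0 : (0 : ℝ) < (m : ℝ) + 1 := by positivity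
  have hdiff : ((m : ℝ) + 1) ^ ρ - (m : ℝ) ^ ρ ≤ ρ * ((m : ℝ) + 1) ^ (ρ - 1) := by
    -- Bernoulli's inequality at -1/(m+1) replaces the mean value theorem.
    have hb := one_add_mul_self_le_rpow_one_add (s := -(1 / ((m : ℝ) + 1))) (by
      rw [neg_le_neg_iff, div_le_one hm0]
      linarith [(m.cast_nonneg : (0 : ℝ) ≤ m)]) hρ
    have he : 1 + -(1 / ((m : ℝ) + 1)) = m / ((m : ℝ) + 1) := by field_simp; ring
    rw [he, Real.div_rpow (by positivity) hm0.le, le_div_iff₀ (by positivity)] at hb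
    rw [Real.rpow_sub_one hm0.ne']
    have : (1 + ρ * -(1 / ((m : ℝ) + 1))) * ((m : ℝ) + 1) ^ ρ =
        ((m : ℝ) + 1) ^ ρ - ρ * (((m : ℝ) + 1) ^ ρ / ((m : ℝ) + 1)) := by field_simp; ring
    linarith
  have hmain : ((m : ℝ) + 1) ^ (ρ - 1) ≤ 2 ^ (ρ - 1) * X ^ (1 - 1 / ρ) := by
    calc ((m : ℝ) + 1) ^ (ρ - 1) ≤ (2 * X ^ (1 / ρ)) ^ (ρ - 1) := by
          gcongr
      _ = 2 ^ (ρ - 1) * X ^ (1 - 1 / ρ) := by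
          rw [Real.mul_rpow (by norm_num) (by positivity), ← Real.rpow_mul (by linarith)]
          congr 2
          field_simp
  have hX1 : 1 ≤ X ^ (1 - 1 / ρ) := Real.one_le_rpow hX (by
    rw [sub_nonneg, div_le_one hρ0]
    exact hρ)
  refine ⟨⌊(m : ℝ) ^ ρ⌋₊, ?_, (Nat.floor_le (by positivity)).trans hm1, ?_⟩
  · rw [suppSet_floorPowSeries]
    exact ⟨m, rfl⟩
  · have h1 := (Nat.lt_floor_add_one ((m : ℝ) ^ ρ)).le
    have h2 := mul_le_mul_of_nonneg_left hmain hρ0.le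
    linarith

/-- Greedy approximation from below by sums of `K` numbers of the form `⌊m ^ ρ⌋`. -/
theorem exists_mem_suppSet_pow_near {ρ : ℝ} (hρ : 1 ≤ ρ) (K : ℕ) :
    ∃ C : ℝ, 1 ≤ C ∧ ∀ X x : ℝ, 1 ≤ X → 0 ≤ x → x ≤ X →
      ∃ a ∈ suppSet (floorPowSeries ρ ^ K), (a : ℝ) ≤ x ∧ x - a ≤ C * X ^ (1 - 1 / ρ) ^ K := by
  induction K with
  | zero =>
    refine ⟨1, le_rfl, fun X x _ hx0 hxX => ⟨0, by simpa using zero_mem_suppSet_one, ?_, ?_⟩⟩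
    · simpa using hx0
    · simpa using hxX
  | succ K ih =>
    obtain ⟨C, hC, h⟩ := ih
    have hρ0 : 0 < ρ := by linarith
    set C₁ := ρ * 2 ^ (ρ - 1) + 1 with hC₁
    have hC₁1 : 1 ≤ C₁ := by
      have : 0 ≤ ρ * (2 : ℝ) ^ (ρ - 1) := by positivity
      linarith
    have hr : 0 ≤ 1 - 1 / ρ := by
      rw [sub_nonneg, div_le_one hρ0]
      exact hρ
    refine ⟨C * C₁ ^ (1 - 1 / ρ) ^ K,
      one_le_mul_of_one_le_of_one_le hC (Real.one_le_rpow hC₁1 (pow_nonneg hr K)),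
      fun X x hX hx0 hxX => ?_⟩
    -- One floor lowers the scale from X to C₁ X^(1-1/ρ), at which the induction hypothesis is
    -- applied to `x - s`.
    obtain ⟨s, hs, hsx, hs'⟩ := exists_floor_rpow_near hρ hx0 hxX hX
    obtain ⟨a, ha, hax, ha'⟩ := h (C₁ * X ^ (1 - 1 / ρ)) (x - s)
      (one_le_mul_of_one_le_of_one_le hC₁1 (Real.one_le_rpow hX hr)) (by linarith) hs'
    refine ⟨a + s, ?_, by push_cast; linarith, ?_⟩
    · rw [pow_succ]
      exact add_mem_suppSet_mul ha hs
    · rw [Real.mul_rpow (by linarith) (by positivity), ← Real.rpow_mul (by linarith),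
        ← pow_succ', ← mul_assoc] at ha'
      push_cast
      linarith

/-! ### Combinatorics of gaps and blocks. -/

/-- Pigeonhole: one more disjoint block than there are points to avoid. -/
theorem exists_free_block (F : Finset ℕ) {N G : ℕ} (h : (F.card + 1) * G ≤ N) :
    ∃ u, N ≤ u ∧ u + G ≤ 2 * N ∧ ∀ n ∈ F, ¬(u < n ∧ n ≤ u + G) := by
  by_contra! hcon
  have hblock : ∀ j ∈ Finset.range (F.card + 1), ∃ n ∈ F, N + j * G < n ∧ n ≤ N + j * G + G := by
    intro j hj
    have hj' : j + 1 ≤ F.card + 1 := Finset.mem_range.1 hj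
    have := Nat.mul_le_mul_right G hj'
    refine hcon (N + j * G) (by omega) ?_
    rw [add_mul, one_mul] at this
    omega
  choose! φ hφ using hblock
  obtain ⟨i, hi, j, hj, hij, heq⟩ := Finset.exists_ne_map_eq_of_card_lt_of_maps_to
    (s := Finset.range (F.card + 1)) (t := F) (by simp) (f := φ) fun j hj => (hφ j hj).1
  have h1 := (hφ i hi).2
  have h2 := (hφ j hj).2
  rw [heq] at h1
  rcases lt_or_gt_of_ne hij with hlt | hlt
  · have := Nat.mul_le_mul_right G (Nat.succ_le_of_lt hlt)
    rw [Nat.succ_mul] at this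
    omega
  · have := Nat.mul_le_mul_right G (Nat.succ_le_of_lt hlt)
    rw [Nat.succ_mul] at this
    omega

/-- The counting argument inside a block free of `Λ₂`: the block is short. -/
theorem block_length_le {Λ₁ Λ₂ Θ S : Set ℕ} {Z : ℕ → Prop} {N u G w C T a₀ : ℕ} (E : Finset ℕ)
    (hC : 1 ≤ C) (huG : u + G ≤ 2 * N) (hw : w ≤ N)
    (hfree : ∀ n ∈ Λ₂, ¬(u < n ∧ n ≤ u + G)) (ha₀ : a₀ ∈ Λ₁) (hua : u < a₀)
    (hau : 4 * a₀ ≤ 4 * u + G) (hS : ∀ t, T ≤ t → ∃ s ∈ S, t ≤ s ∧ s ≤ C * t)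
    (hadd : ∀ a ∈ Λ₁, ∀ s ∈ S, a + s ∈ Λ₁ ∪ Θ)
    (hE : ∀ n ∈ Λ₁ ∪ Λ₂ ∪ Θ, n < 4 * N → n ∈ E)
    (hZ₁ : ∀ R ≤ 4 * N, Z R → ∃ n ∈ Λ₁ ∪ Λ₂ ∪ Θ, R < n ∧ n ≤ R + w)
    (hZ₂ : ∀ R ≤ 4 * N, ∀ θ ≤ 4 * N, R < θ → θ ∈ Θ →
      (∀ n, R < n → n ≤ θ + w → n ∉ Λ₁ ∧ n ∉ Λ₂) → Z R) :
    G ≤ 4 * (E.card * (2 * C * (w + T + 1)) + E.card * w * (2 * C)) := by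
  classical
  set W := 2 * C * (w + T + 1) with hW
  set pred : ℕ → ℕ := fun R => Nat.findGreatest (· ∈ Λ₁) R with hpred
  have hpred_mem : ∀ R, a₀ ≤ R → pred R ∈ Λ₁ := fun R hR =>
    Nat.findGreatest_spec (P := (· ∈ Λ₁)) hR ha₀
  have hpred_le : ∀ R, pred R ≤ R := fun R => Nat.findGreatest_le R
  have hle_pred : ∀ R n, n ∈ Λ₁ → n ≤ R → n ≤ pred R := fun R n hn hR =>
    Nat.le_findGreatest hR hn
  set I := Finset.Icc a₀ (u + G / 2) with hI
  set near := I.filter fun R => R < pred R + W with hnear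
  set far := I.filter fun R => ¬R < pred R + W with hfar
  set NZ := (Finset.range (u + G + 1)).filter Z with hNZ
  -- `x R` lies a fraction 1/(2C) of the way from `pred R` to `R`. For `R` far from `pred R`, an `s`
  -- in `S` can then be found with `x R < pred R + s` and `pred R + s + w ≤ R`.
  set x : ℕ → ℕ := fun R => pred R + (R - pred R) / (2 * C) with hx
  -- `a₀` lies in the first quarter of the block and `I` runs to its middle.
  have hIcard : G ≤ 4 * I.card := by
    rw [hI, Nat.card_Icc]
    omega
  have hsplit : near.card + far.card = I.card := Finset.card_filter_add_card_filter_not _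
  have hnear_card : near.card ≤ E.card * W := by
    have hsub : near ⊆ (E ×ˢ Finset.range W).image fun p => p.1 + p.2 := by
      intro R hR
      obtain ⟨hRI, hRW⟩ := Finset.mem_filter.1 hR
      obtain ⟨h1, h2⟩ := Finset.mem_Icc.1 hRI
      have h3 := hpred_le R
      refine Finset.mem_image.2 ⟨(pred R, R - pred R), Finset.mem_product.2 ⟨hE _ ?_ ?_, ?_⟩, ?_⟩
      · exact Or.inl (Or.inl (hpred_mem R h1))
      · dsimp only
        omega
      · exact Finset.mem_range.2 (by dsimp only; omega)
      · dsimp only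
        omega
    refine (Finset.card_le_card hsub).trans (Finset.card_image_le.trans ?_)
    rw [Finset.card_product, Finset.card_range]
  have hNZ_card : NZ.card ≤ E.card * w := by
    have hsub : NZ ⊆ (E ×ˢ Finset.range w).image fun p => p.1 - 1 - p.2 := by
      intro R hR
      obtain ⟨hR, hZR⟩ := Finset.mem_filter.1 hR
      have hR' := Finset.mem_range.1 hR
      obtain ⟨n, hn, h1, h2⟩ := hZ₁ R (by omega) hZR
      refine Finset.mem_image.2 ⟨(n, n - 1 - R), Finset.mem_product.2 ⟨hE _ hn ?_, ?_⟩, ?_⟩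
      · omega
      · exact Finset.mem_range.2 (by dsimp only; omega)
      · dsimp only
        omega
    refine (Finset.card_le_card hsub).trans (Finset.card_image_le.trans ?_)
    rw [Finset.card_product, Finset.card_range]
  have hxR : ∀ R, x R ≤ R := fun R => by
    have := Nat.div_le_self (R - pred R) (2 * C)
    have := hpred_le R
    simp only [hx]
    omega
  have hpredx : ∀ R, a₀ ≤ R → pred (x R) = pred R := by
    intro R hR
    refine le_antisymm ?_ (hle_pred _ _ (hpred_mem R hR) (Nat.le_add_right _ _))
    have h1 : a₀ ≤ x R := (hle_pred R a₀ ha₀ hR).trans (Nat.le_add_right _ _)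
    exact hle_pred _ _ (hpred_mem _ h1) ((hpred_le _).trans (hxR R))
  have hfar_card : far.card ≤ NZ.card * (2 * C) := by
    have hmaps : ∀ R ∈ far, (x R, (R - pred R) % (2 * C)) ∈ NZ ×ˢ Finset.range (2 * C) := by
      intro R hR
      obtain ⟨hRI, hRW⟩ := Finset.mem_filter.1 hR
      obtain ⟨h1, h2⟩ := Finset.mem_Icc.1 hRI
      have h3 := hpred_le R
      have h4 := hxR R
      have ha := hpred_mem R h1
      have h5 := hle_pred R a₀ ha₀ h1
      refine Finset.mem_product.2 ⟨Finset.mem_filter.2 ⟨Finset.mem_range.2 ?_, ?_⟩,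
        Finset.mem_range.2 (Nat.mod_lt _ (by omega))⟩
      · dsimp only
        omega
      dsimp only
      set a := pred R
      set D := R - a with hD
      set t := D / (2 * C) with ht
      have hxt : x R = a + t := rfl
      have hDW : 2 * C * (w + T + 1) ≤ D := by omega
      have htW : w + T + 1 ≤ t := by
        rw [ht, Nat.le_div_iff_mul_le (by omega)]
        linarith
      obtain ⟨s, hs, hts, hsC⟩ := hS (t + 1) (by omega)
      have hDt : 2 * (C * t) ≤ D := by
        have := Nat.div_mul_le_self D (2 * C)
        rw [← ht] at this
        nlinarith
      have hCw : 2 * w + 2 * C ≤ D := by nlinarith [Nat.mul_le_mul hC (le_refl w)]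
      have hsw : s + w ≤ D := by
        rw [mul_add, mul_one] at hsC
        omega
      have hΛ₁ : ∀ n, a < n → n ≤ R → n ∉ Λ₁ := fun n hn hnR hmem =>
        absurd (hle_pred R n hmem hnR) (not_le.2 hn)
      -- `a` is the last element of `Λ₁` up to `R`, so the sum has to leave `Λ₁`.
      have hθ : a + s ∈ Θ := (hadd a ha s hs).resolve_left (hΛ₁ _ (by omega) (by omega))
      refine hZ₂ _ (by omega) (a + s) (by omega) (by omega) hθ fun n hn hn' => ⟨?_, fun hmem => ?_⟩
      · exact hΛ₁ n (by omega) (by omega)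
      · exact hfree n hmem ⟨by omega, by omega⟩
    -- `x R` determines `pred R`, hence the quotient; the remainder then gives back `R`.
    have hinj : Set.InjOn (fun R => (x R, (R - pred R) % (2 * C))) far := by
      intro R hR R' hR' heq
      obtain ⟨hRI, -⟩ := Finset.mem_filter.1 hR
      obtain ⟨hRI', -⟩ := Finset.mem_filter.1 hR'
      have h1 := (Finset.mem_Icc.1 hRI).1
      have h1' := (Finset.mem_Icc.1 hRI').1
      obtain ⟨hxx, hmod⟩ := Prod.mk.inj heq
      have hp : pred R = pred R' := by rw [← hpredx R h1, hxx, hpredx R' h1']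
      have hdiv : (R - pred R) / (2 * C) = (R' - pred R') / (2 * C) := by
        simp only [hx] at hxx
        omega
      have hD : R - pred R = R' - pred R' := by
        rw [← Nat.div_add_mod (R - pred R) (2 * C), hdiv, hmod, Nat.div_add_mod]
      have := hpred_le R
      have := hpred_le R'
      omega
    refine (Finset.card_le_card_of_injOn _ hmaps hinj).trans ?_
    rw [Finset.card_product, Finset.card_range]
  have := Nat.mul_le_mul_right (2 * C) hNZ_card
  omega

/-! ### Computability of constant functions. -/

theorem primrec_two_pow : Primrec fun n : ℕ => 2 ^ n := by
  refine (Primrec.nat_rec₁ (f := fun _ m => 2 * m) 1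
    (Primrec.nat_mul.comp (Primrec.const 2) Primrec.snd).to₂).of_eq fun n => ?_
  induction n with
  | zero => rfl
  | succ n ih => rw [pow_succ', ← ih]

/-- The code of a nonnegative integer n is 2n. -/
theorem primrec_natCast_int : Primrec fun n : ℕ => (n : ℤ) := by
  refine Primrec.encode_iff.1 ((Primrec.nat_mul.comp (Primrec.const 2) Primrec.id).of_eq
    fun n => ?_)
  rfl

theorem isComputableOnPos_natCast (c : ℕ) : IsComputableOnPos fun _ => (c : ℝ) := by
  refine ⟨fun t => ((c * 2 ^ t.2.2 : ℕ) : ℤ), fun _ => 0, ?_, Computable.const 0, ?_, ?_⟩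
  · exact (primrec_natCast_int.comp (Primrec.nat_mul.comp (Primrec.const c)
      (primrec_two_pow.comp (Primrec.snd.comp Primrec.snd)))).to_comp
  · intro p q n _ _
    push_cast
    rw [mul_div_cancel_right₀ _ (by positivity), sub_self, abs_zero]
    positivity
  · intro k n x y _ _ _
    rw [sub_self, abs_zero]
    positivity

/-! ### Counting the exponents below 4N. -/

theorem eventually_const_mul_rpow_lt {a b : ℝ} (h : a < b) (c : ℝ) :
    ∀ᶠ N : ℕ in atTop, c * (N : ℝ) ^ a < (N : ℝ) ^ b := by
  have h1 := ((tendsto_rpow_atTop (sub_pos.2 h)).comp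
    tendsto_natCast_atTop_atTop).eventually_gt_atTop c
  filter_upwards [h1, eventually_ge_atTop 1] with N hN hN1
  have hN0 : (0 : ℝ) < N := by exact_mod_cast hN1
  simp only [Function.comp] at hN
  calc c * (N : ℝ) ^ a < (N : ℝ) ^ (b - a) * (N : ℝ) ^ a := by gcongr
    _ = (N : ℝ) ^ b := by rw [← Real.rpow_add hN0, sub_add_cancel]

theorem countBelow_floorPowSeries_le {ρ : ℝ} (hρ : 1 ≤ ρ) {N : ℕ} (hN : 1 ≤ N) :
    (countBelow (suppSet (floorPowSeries ρ)) (4 * N) : ℝ) ≤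
      ((4 : ℝ) ^ (1 / ρ) + 1) * (N : ℝ) ^ (1 / ρ) := by
  have hρ0 : 0 < ρ := by linarith
  have hN' : (1 : ℝ) ≤ N := by exact_mod_cast hN
  have hsub : {n : ℕ | n ∈ suppSet (floorPowSeries ρ) ∧ (n : ℝ) < 4 * N} ⊆
      ((Finset.range ⌈(4 * (N : ℝ)) ^ (1 / ρ)⌉₊).image fun m : ℕ => ⌊(m : ℝ) ^ ρ⌋₊ : Finset ℕ) := by
    rintro n ⟨hn, hnN⟩
    rw [suppSet_floorPowSeries] at hn
    obtain ⟨m, rfl⟩ := hn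
    refine Finset.mem_coe.2 (Finset.mem_image.2 ⟨m, Finset.mem_range.2 (Nat.lt_ceil.2 ?_), rfl⟩)
    have h1 : ⌊(m : ℝ) ^ ρ⌋₊ < 4 * N := by exact_mod_cast hnN
    have h2 : (m : ℝ) ^ ρ < 4 * N := by exact_mod_cast (Nat.floor_lt (by positivity)).1 h1
    rw [one_div, Real.lt_rpow_inv_iff_of_pos (by positivity) (by positivity) hρ0]
    exact h2
  have hcard := Set.ncard_le_ncard hsub (Finset.finite_toSet _)
  rw [Set.ncard_coe_finset] at hcard
  have h3 := hcard.trans (Finset.card_image_le.trans (Finset.card_range _).le)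
  have h4 : (countBelow (suppSet (floorPowSeries ρ)) (4 * N) : ℝ) ≤
      (⌈(4 * (N : ℝ)) ^ (1 / ρ)⌉₊ : ℝ) := Nat.cast_le.2 h3
  have h5 := (Nat.ceil_lt_add_one (a := (4 * (N : ℝ)) ^ (1 / ρ)) (by positivity)).le
  rw [Real.mul_rpow (by norm_num) (by positivity)] at h4 h5
  have h6 : 1 ≤ (N : ℝ) ^ (1 / ρ) := Real.one_le_rpow hN' (by positivity)
  linarith

theorem exists_eventually_countBelow_le {ρ : ℝ} (hρ : 1 ≤ ρ) {g : PowerSeries ℕ}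
    (hg : ∀ ε : ℝ, 0 < ε → Asymptotics.IsLittleO atTop
      (fun R : ℝ => (countBelow (suppSet g) R : ℝ)) (fun R : ℝ => R ^ ε))
    (k l : ℕ) {ε : ℝ} (hε : 0 < ε) :
    ∃ c : ℝ, ∀ᶠ N : ℕ in atTop,
      (countBelow (suppSet (floorPowSeries ρ ^ k * g ^ l)) (4 * N) : ℝ) ≤
        c * (N : ℝ) ^ (k * (1 / ρ) + ε) := by
  -- The `l` factors `g` together cost at most ε; the `+ 1` covers `l = 0`.
  set δ := ε / (l + 1) with hδ
  have hδ0 : 0 < δ := by positivity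
  have hlδ : l * δ ≤ ε := by
    rw [hδ, mul_div_assoc', div_le_iff₀ (by positivity)]
    nlinarith
  refine ⟨((4 : ℝ) ^ (1 / ρ) + 1) ^ k * ((4 : ℝ) ^ δ) ^ l, ?_⟩
  have h4N : Tendsto (fun N : ℕ => 4 * (N : ℝ)) atTop atTop :=
    tendsto_natCast_atTop_atTop.const_mul_atTop (by norm_num)
  filter_upwards [h4N.eventually ((hg δ hδ0).def one_pos), eventually_ge_atTop 1] with N hN hN1
  have hN' : (1 : ℝ) ≤ N := by exact_mod_cast hN1
  have hN0 : (0 : ℝ) < N := by linarith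
  rw [one_mul, Real.norm_of_nonneg (by positivity), Real.norm_of_nonneg (by positivity),
    Real.mul_rpow (by norm_num) hN0.le] at hN
  have h1 : countBelow (suppSet (floorPowSeries ρ ^ k * g ^ l)) (4 * N) ≤
      countBelow (suppSet (floorPowSeries ρ)) (4 * N) ^ k * countBelow (suppSet g) (4 * N) ^ l :=
    (countBelow_suppSet_mul _ _ _).trans
      (Nat.mul_le_mul (countBelow_suppSet_pow _ _ _) (countBelow_suppSet_pow _ _ _))
  calc (countBelow (suppSet (floorPowSeries ρ ^ k * g ^ l)) (4 * N) : ℝ)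
      ≤ (countBelow (suppSet (floorPowSeries ρ)) (4 * N) : ℝ) ^ k *
          (countBelow (suppSet g) (4 * N) : ℝ) ^ l := by exact_mod_cast h1
    _ ≤ (((4 : ℝ) ^ (1 / ρ) + 1) * (N : ℝ) ^ (1 / ρ)) ^ k * (4 ^ δ * (N : ℝ) ^ δ) ^ l := by
        gcongr
        exact countBelow_floorPowSeries_le hρ hN1
    _ = ((4 : ℝ) ^ (1 / ρ) + 1) ^ k * ((4 : ℝ) ^ δ) ^ l * (N : ℝ) ^ (k * (1 / ρ) + l * δ) := by
        rw [mul_pow, mul_pow, ← Real.rpow_natCast ((N : ℝ) ^ (1 / ρ)),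
          ← Real.rpow_natCast ((N : ℝ) ^ δ), ← Real.rpow_mul hN0.le, ← Real.rpow_mul hN0.le,
          Real.rpow_add hN0, mul_comm (1 / ρ), mul_comm δ]
        ring
    _ ≤ _ := by gcongr

/-- The exponents occurring in the products `f ^ k * g ^ l` with `(k, l) ∈ P`. -/
def suppUnion (f g : PowerSeries ℕ) (P : Finset (ℕ × ℕ)) : Set ℕ :=
  {n | ∃ q ∈ P, n ∈ suppSet (f ^ q.1 * g ^ q.2)}

theorem suppUnion_finset_bound {ρ : ℝ} (hρ : 1 ≤ ρ) {g : PowerSeries ℕ}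
    (hg : ∀ ε : ℝ, 0 < ε → Asymptotics.IsLittleO atTop
      (fun R : ℝ => (countBelow (suppSet g) R : ℝ)) (fun R : ℝ => R ^ ε))
    (P : Finset (ℕ × ℕ)) {κ : ℝ} (hP : ∀ q ∈ P, (q.1 : ℝ) ≤ κ) {ε : ℝ} (hε : 0 < ε) :
    ∃ E : ℕ → Finset ℕ, (∀ N, ∀ n ∈ suppUnion (floorPowSeries ρ) g P, n < 4 * N → n ∈ E N) ∧
      ∀ᶠ N : ℕ in atTop, ((E N).card : ℝ) ≤ (N : ℝ) ^ (κ * (1 / ρ) + ε) := by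
  classical
  refine ⟨fun N => P.biUnion fun q =>
    (finite_inter_lt (suppSet (floorPowSeries ρ ^ q.1 * g ^ q.2)) (4 * N)).toFinset, ?_, ?_⟩
  · rintro N n ⟨q, hq, hn⟩ hnN
    exact Finset.mem_biUnion.2 ⟨q, hq, (Set.Finite.mem_toFinset _).2
      ⟨hn, by exact_mod_cast hnN⟩⟩
  -- The factor `P.card + 1` prepares the sum over `P`, and half of ε absorbs the constants.
  · have hq : ∀ q ∈ P, ∀ᶠ N : ℕ in atTop,
        (countBelow (suppSet (floorPowSeries ρ ^ q.1 * g ^ q.2)) (4 * N) : ℝ) * (P.card + 1) ≤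
          (N : ℝ) ^ (κ * (1 / ρ) + ε) := by
      intro q hq
      obtain ⟨c, hc⟩ := exists_eventually_countBelow_le hρ hg q.1 q.2 (half_pos hε)
      have hlt : (q.1 : ℝ) * (1 / ρ) + ε / 2 < κ * (1 / ρ) + ε := by
        have : (q.1 : ℝ) * (1 / ρ) ≤ κ * (1 / ρ) :=
          mul_le_mul_of_nonneg_right (hP q hq) (by positivity)
        linarith
      filter_upwards [hc, eventually_const_mul_rpow_lt hlt (c * (P.card + 1))] with N h1 h2
      have := mul_le_mul_of_nonneg_right h1 (by positivity : (0 : ℝ) ≤ P.card + 1)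
      linarith
    filter_upwards [(eventually_all_finset P).2 hq] with N hN
    have hcard : (P.biUnion fun q =>
        (finite_inter_lt (suppSet (floorPowSeries ρ ^ q.1 * g ^ q.2)) (4 * N)).toFinset).card ≤
          ∑ q ∈ P, countBelow (suppSet (floorPowSeries ρ ^ q.1 * g ^ q.2)) (4 * N) := by
      refine Finset.card_biUnion_le.trans (Finset.sum_le_sum fun q _ => ?_)
      rw [countBelow, Set.ncard_eq_toFinset_card _ (finite_inter_lt _ _)]
    have hpos : (0 : ℝ) < P.card + 1 := by positivity
    have hX : 0 ≤ (N : ℝ) ^ (κ * (1 / ρ) + ε) := by positivity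
    calc _ ≤ ∑ q ∈ P, (countBelow (suppSet (floorPowSeries ρ ^ q.1 * g ^ q.2)) (4 * N) : ℝ) := by
          exact_mod_cast hcard
      _ ≤ ∑ _q ∈ P, (N : ℝ) ^ (κ * (1 / ρ) + ε) / (P.card + 1) :=
          Finset.sum_le_sum fun q hq => (le_div_iff₀ hpos).2 (hN q hq)
      _ = P.card / (P.card + 1) * (N : ℝ) ^ (κ * (1 / ρ) + ε) := by
          rw [Finset.sum_const, nsmul_eq_mul]
          ring
      _ ≤ _ := by
          refine mul_le_of_le_one_left hX ((div_le_one hpos).2 ?_)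
          linarith

/-! ### Coefficients of a relation, in the unit disc and at β. -/

theorem exists_norm_aeval_bound (p : Polynomial ℤ) (β : ℝ) :
    ∃ b : ℕ, (∀ z : ℂ, ‖z‖ ≤ 1 → ‖Polynomial.aeval z p‖ ≤ b) ∧ |Polynomial.aeval β p| ≤ b := by
  obtain ⟨b, hb⟩ := exists_nat_ge
    (max (∑ i ∈ Finset.range (p.natDegree + 1), |((p.coeff i : ℤ) : ℝ)|) |Polynomial.aeval β p|)
  refine ⟨b, fun z hz => ((?_ : _ ≤ _).trans (le_max_left _ _)).trans hb,
    (le_max_right _ _).trans hb⟩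
  rw [Polynomial.aeval_eq_sum_range]
  refine (norm_sum_le _ _).trans (Finset.sum_le_sum fun i _ => ?_)
  rw [zsmul_eq_mul, norm_mul, norm_pow, Complex.norm_intCast]
  exact mul_le_of_le_one_right (abs_nonneg _) (pow_le_one₀ (norm_nonneg z) hz)

/-- Coefficients `∑ i, r i n • p i` with `r i` of polynomial growth grow polynomially on the closed
unit disc and at `β`. -/
theorem exists_polyGrowth_bound {ι : Type*} (T : Finset ι) (F : ι → PowerSeries ℕ)
    (hF : ∀ i, PolyBounded (F i)) (p : ι → Polynomial ℤ) (β : ℝ) :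
    ∃ B D : ℕ, (∀ n (z : ℂ), ‖z‖ ≤ 1 →
        ‖Polynomial.aeval z (∑ i ∈ T, PowerSeries.coeff n (F i) • p i)‖ ≤
          B * ((n : ℝ) + 1) ^ D) ∧
      ∀ n, |Polynomial.aeval β (∑ i ∈ T, PowerSeries.coeff n (F i) • p i)| ≤
        B * ((n : ℝ) + 1) ^ D := by
  classical
  choose b hb₁ hb₂ using fun i => exists_norm_aeval_bound (p i) β
  choose B D hBD using hF
  have key : ∀ n : ℕ, ∑ i ∈ T, ((PowerSeries.coeff n (F i) : ℕ) : ℝ) * b i ≤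
      ((∑ i ∈ T, B i * b i : ℕ) : ℝ) * ((n : ℝ) + 1) ^ (∑ i ∈ T, D i) := by
    intro n
    push_cast
    rw [Finset.sum_mul]
    refine Finset.sum_le_sum fun i hi => ?_
    have h1 : ((PowerSeries.coeff n (F i) : ℕ) : ℝ) ≤ B i * ((n : ℝ) + 1) ^ D i := by
      exact_mod_cast hBD i n
    have h2 : ((n : ℝ) + 1) ^ D i ≤ ((n : ℝ) + 1) ^ (∑ i ∈ T, D i) :=
      pow_le_pow_right₀ (by linarith [(n.cast_nonneg : (0 : ℝ) ≤ n)])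
        (Finset.single_le_sum (f := D) (fun _ _ => Nat.zero_le _) hi)
    calc _ ≤ (B i * ((n : ℝ) + 1) ^ (∑ i ∈ T, D i)) * b i := by
          gcongr
          exact h1.trans (by gcongr)
      _ = _ := by ring
  refine ⟨∑ i ∈ T, B i * b i, ∑ i ∈ T, D i, fun n z hz => ?_, fun n => ?_⟩
  · refine le_trans ?_ (key n)
    rw [map_sum]
    refine (norm_sum_le _ _).trans (Finset.sum_le_sum fun i _ => ?_)
    rw [map_nsmul, nsmul_eq_mul, norm_mul, Complex.norm_natCast]
    gcongr
    exact hb₁ i z hz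
  · refine le_trans ?_ (key n)
    rw [map_sum]
    refine (Finset.abs_sum_le_sum_abs _ _).trans (Finset.sum_le_sum fun i _ => ?_)
    rw [map_nsmul, nsmul_eq_mul, abs_mul, Nat.abs_cast]
    gcongr
    exact hb₂ i

theorem tsum_aeval_sum {ι : Type*} (T : Finset ι) (F : ι → PowerSeries ℕ)
    (hF : ∀ i, PolyBounded (F i)) (p : ι → Polynomial ℤ) (β : ℝ) {x : ℝ} (hx0 : 0 ≤ x)
    (hx1 : x < 1) :
    ∑' n, Polynomial.aeval β (∑ i ∈ T, PowerSeries.coeff n (F i) • p i) * x ^ n =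
      ∑ i ∈ T, Polynomial.aeval β (p i) * seriesValue (F i) x := by
  simp only [seriesValue, ← tsum_mul_left]
  rw [← Summable.tsum_finsetSum fun i _ => ((hF i).summable hx0 hx1).mul_left _]
  refine tsum_congr fun n => ?_
  rw [map_sum, Finset.sum_mul]
  refine Finset.sum_congr rfl fun i _ => ?_
  rw [map_nsmul, nsmul_eq_mul]
  ring

/-! ### The contradiction from sparsity. -/

theorem polyBounded_of_mem_classF {g : PowerSeries ℕ} (hg : g ∈ classF) : PolyBounded g := by
  obtain ⟨-, ⟨B, hB⟩, -⟩ := hg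
  exact ⟨B, 0, fun n => by simpa using hB n⟩

theorem exists_mem_suppSet_near {g : PowerSeries ℕ} (hg : g ∈ classF) :
    ∃ C T : ℕ, 1 ≤ C ∧ ∀ t, T ≤ t → ∃ s ∈ suppSet g, t ≤ s ∧ s ≤ C * t := by
  obtain ⟨-, -, -, C, hC, h⟩ := hg
  obtain ⟨T, hT⟩ := eventually_atTop.1 (tendsto_natCast_atTop_atTop.eventually h)
  refine ⟨⌈C⌉₊, T, Nat.ceil_pos.2 hC, fun t ht => ?_⟩
  obtain ⟨_, ⟨h1, h2⟩, s, hs, rfl⟩ := hT t ht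
  refine ⟨s, hs, Nat.cast_le.1 h1, ?_⟩
  have : (s : ℝ) ≤ (⌈C⌉₊ : ℝ) * t :=
    h2.trans (mul_le_mul_of_nonneg_right (Nat.le_ceil C) t.cast_nonneg)
  exact_mod_cast this

/-- One more factor `g` raises the exponent of `g` by one, which leaves the range only at `L`. This
is the additivity hypothesis of `block_length_le`. -/
theorem add_mem_suppUnion {f g : PowerSeries ℕ} {K L a s : ℕ}
    (ha : a ∈ suppUnion f g ({K} ×ˢ Finset.range L)) (hs : s ∈ suppSet g) :
    a + s ∈ suppUnion f g ({K} ×ˢ Finset.range L) ∪ suppSet (f ^ K * g ^ L) := by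
  obtain ⟨⟨k, l⟩, hq, ha⟩ := ha
  obtain ⟨hk, hl⟩ := Finset.mem_product.1 hq
  obtain rfl : k = K := Finset.mem_singleton.1 hk
  have hl' : l < L := Finset.mem_range.1 hl
  have hmem : a + s ∈ suppSet (f ^ k * g ^ (l + 1)) := by
    rw [pow_succ, ← mul_assoc]
    exact add_mem_suppSet_mul ha hs
  rcases (Nat.succ_le_of_lt hl').lt_or_eq with h | h
  · exact Or.inl ⟨(k, l + 1), Finset.mem_product.2 ⟨hk, Finset.mem_range.2 h⟩, hmem⟩
  · rw [← h]
    exact Or.inr hmem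

/-- The exponents of the products `f ^ k * g ^ l` are too sparse for a set such as the one provided
by `exists_nonvanishing_set`. -/
theorem not_nonvanishing_set {ρ e : ℝ} {K L : ℕ} {g : PowerSeries ℕ} (hρ : 1 < ρ) (hK : 1 ≤ K)
    (hL : 1 ≤ L) (hg : g ∈ classF) (he0 : 0 < e) (he1 : e < 1)
    (hτ : (1 - 1 / ρ) ^ K < 1 - (K - 1) * (1 / ρ) - 2 * e)
    (hγ : K * (1 / ρ) + 2 * e < 1 - (K - 1) * (1 / ρ) - 2 * e)
    (P : Finset (ℕ × ℕ)) (hP : ∀ q ∈ P, q.1 < K) (Z : ℕ → Prop)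
    (hZ : ∀ᶠ N : ℕ in atTop, ∀ R ≤ 4 * N,
      (Z R → ∃ n ∈ suppUnion (floorPowSeries ρ) g ({K} ×ˢ Finset.range L) ∪
        suppUnion (floorPowSeries ρ) g P ∪ suppSet (floorPowSeries ρ ^ K * g ^ L),
          R < n ∧ n ≤ R + ⌈(N : ℝ) ^ e⌉₊) ∧
      ∀ θ ≤ 4 * N, R < θ → θ ∈ suppSet (floorPowSeries ρ ^ K * g ^ L) →
        (∀ n, R < n → n ≤ θ + ⌈(N : ℝ) ^ e⌉₊ →
          n ∉ suppUnion (floorPowSeries ρ) g ({K} ×ˢ Finset.range L) ∧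
            n ∉ suppUnion (floorPowSeries ρ) g P) → Z R) : False := by
  classical
  have hρ0 : 0 < ρ := by linarith
  have hr0 : 0 < 1 / ρ := by positivity
  have hr1 : 0 ≤ 1 - 1 / ρ := by
    rw [sub_nonneg, div_le_one hρ0]
    exact hρ.le
  have hK1 : (1 : ℝ) ≤ K := by exact_mod_cast hK
  obtain ⟨C, T, hC, hS⟩ := exists_mem_suppSet_near hg
  obtain ⟨s₀, hs₀, -⟩ := hS T le_rfl
  obtain ⟨C₀, hC₀, hgreedy⟩ := exists_mem_suppSet_pow_near hρ.le K
  obtain ⟨E₂, hE₂, hE₂card⟩ := suppUnion_finset_bound hρ.le hg.2.2.1 P (κ := (K : ℝ) - 1)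
    (fun q hq => by
      have : ((q.1 + 1 : ℕ) : ℝ) ≤ K := by exact_mod_cast hP q hq
      push_cast at this
      linarith) he0
  obtain ⟨E, hE, hEcard⟩ := suppUnion_finset_bound hρ.le hg.2.2.1
    (P ∪ {K} ×ˢ Finset.range (L + 1)) (κ := (K : ℝ))
    (fun q hq => by
      rcases Finset.mem_union.1 hq with hq | hq
      · exact_mod_cast (hP q hq).le
      · rw [Finset.mem_singleton.1 (Finset.mem_product.1 hq).1]) he0
  set r := 1 / ρ with hr
  set τ := (1 - r) ^ K with hτdef
  have hτ0 : 0 ≤ τ := pow_nonneg hr1 K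
  set γ := 1 - ((K : ℝ) - 1) * r - 2 * e with hγdef
  have hKr : 0 ≤ ((K : ℝ) - 1) * r := mul_nonneg (by linarith) hr0.le
  have hEall : ∀ N, ∀ n ∈ suppUnion (floorPowSeries ρ) g ({K} ×ˢ Finset.range L) ∪
      suppUnion (floorPowSeries ρ) g P ∪ suppSet (floorPowSeries ρ ^ K * g ^ L),
      n < 4 * N → n ∈ E N := by
    rintro N n ((⟨q, hq, hn⟩ | ⟨q, hq, hn⟩) | hn) hnN
    · refine hE N n ⟨q, Finset.mem_union_right _ ?_, hn⟩ hnN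
      exact Finset.product_subset_product_right (Finset.range_subset_range.2 (Nat.le_succ L)) hq
    · exact hE N n ⟨q, Finset.mem_union_left _ hq, hn⟩ hnN
    · exact hE N n ⟨(K, L), Finset.mem_union_right _ (Finset.mem_product.2
        ⟨Finset.mem_singleton_self K, Finset.self_mem_range_succ L⟩), hn⟩ hnN
  obtain ⟨N, hZN, hE₂N, hEN, hb1, hb2, hb3, hb4, hN1, hN2⟩ :=
    (hZ.and (hE₂card.and (hEcard.and ((eventually_const_mul_rpow_lt
      (show 1 - e < 1 by linarith) 2).and ((eventually_const_mul_rpow_lt he1 2).and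
      ((eventually_const_mul_rpow_lt hτ (4 * C₀ * 4 ^ τ + 1)).and
      ((eventually_const_mul_rpow_lt hγ (8 * C * (T + 5) + 1)).and
      ((eventually_ge_atTop 1).and (eventually_ge_atTop ((L - 1) * s₀)))))))))).exists
  have hN : (1 : ℝ) ≤ N := by exact_mod_cast hN1
  have hN0 : (0 : ℝ) < N := by linarith
  rw [Real.rpow_one] at hb1 hb2
  set G := ⌊(N : ℝ) ^ γ⌋₊ with hG
  have hGle : (G : ℝ) ≤ (N : ℝ) ^ γ := Nat.floor_le (by positivity)
  have hGge : (N : ℝ) ^ γ < G + 1 := Nat.lt_floor_add_one _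
  set w := ⌈(N : ℝ) ^ e⌉₊ with hw
  have hNe : 1 ≤ (N : ℝ) ^ e := Real.one_le_rpow hN he0.le
  have hwle : (w : ℝ) ≤ 2 * (N : ℝ) ^ e := by
    have := Nat.ceil_lt_add_one (a := (N : ℝ) ^ e) (by positivity)
    linarith
  have hwN : w ≤ N := by exact_mod_cast hwle.trans hb2.le
  -- The exponents (K-1) r + e and γ add up to 1 - e; the spare e absorbs the factor 2.
  have hblock : ((E₂ N).card + 1) * G ≤ N := by
    have h1 : 1 ≤ (N : ℝ) ^ (((K : ℝ) - 1) * r + e) := Real.one_le_rpow hN (by linarith)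
    have h2 : (((E₂ N).card : ℝ) + 1) * G ≤
        2 * (N : ℝ) ^ (((K : ℝ) - 1) * r + e) * (N : ℝ) ^ γ := by
      gcongr
      linarith
    rw [mul_assoc, ← Real.rpow_add hN0,
      show ((K : ℝ) - 1) * r + e + γ = 1 - e by rw [hγdef]; ring] at h2
    exact_mod_cast h2.trans hb1.le
  obtain ⟨u, hNu, huG, hfree⟩ := exists_free_block (E₂ N) hblock
  have hfree' : ∀ n ∈ suppUnion (floorPowSeries ρ) g P, ¬(u < n ∧ n ≤ u + G) := fun n hn hnu =>
    hfree n (hE₂ N n hn (by omega)) hnu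
  have hu1 : (N : ℝ) ≤ u := by exact_mod_cast hNu
  have hu2 : (u : ℝ) + G ≤ 2 * N := by exact_mod_cast huG
  have hs1 : (((L - 1) * s₀ : ℕ) : ℝ) ≤ N := by exact_mod_cast hN2
  have hs0 : (0 : ℝ) ≤ (((L - 1) * s₀ : ℕ) : ℝ) := Nat.cast_nonneg _
  have hG0 : (0 : ℝ) ≤ G := G.cast_nonneg
  -- Aiming at u + G/4 minus (L-1) s₀ leaves room for `L - 1` copies of `s₀`. The shifted sum is an
  -- exponent of γ^K g^(L-1) in (u, u + G/4].
  obtain ⟨a, ha, hax, ha'⟩ := hgreedy (4 * N) ((u : ℝ) + G / 4 - ((L - 1) * s₀ : ℕ))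
    (by linarith) (by linarith) (by linarith)
  have hNτ : 1 ≤ (N : ℝ) ^ τ := Real.one_le_rpow hN hτ0
  have hsmall : 4 * (C₀ * (4 * (N : ℝ)) ^ τ) < G := by
    rw [Real.mul_rpow (by norm_num) hN0.le]
    linarith
  have ha₀ : a + (L - 1) * s₀ ∈ suppUnion (floorPowSeries ρ) g ({K} ×ˢ Finset.range L) :=
    ⟨(K, L - 1), Finset.mem_product.2 ⟨Finset.mem_singleton_self K,
      Finset.mem_range.2 (by omega)⟩, add_mem_suppSet_mul ha (mul_mem_suppSet_pow hs₀ _)⟩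
  have hua : u < a + (L - 1) * s₀ := by
    have : (u : ℝ) < ((a + (L - 1) * s₀ : ℕ) : ℝ) := by
      rw [Nat.cast_add]
      linarith
    exact_mod_cast this
  have hau : 4 * (a + (L - 1) * s₀) ≤ 4 * u + G := by
    have : 4 * ((a + (L - 1) * s₀ : ℕ) : ℝ) ≤ 4 * u + G := by
      rw [Nat.cast_add]
      linarith
    exact_mod_cast this
  have hlen := block_length_le (Z := Z) (E N) hC huG hwN hfree' ha₀ hua hau hS
    (fun a ha s hs => add_mem_suppUnion ha hs) (hEall N) (fun R hR => (hZN R hR).1)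
    (fun R hR => (hZN R hR).2)
  have hlen' : (G : ℝ) ≤
      4 * ((E N).card * (2 * C * (w + T + 1)) + (E N).card * w * (2 * C)) := by
    exact_mod_cast hlen
  have hfinal : (G : ℝ) ≤ 8 * C * (T + 5) * (N : ℝ) ^ (K * r + 2 * e) := by
    have h1 : 2 * (w : ℝ) + T + 1 ≤ (T + 5) * (N : ℝ) ^ e := by
      have : (T : ℝ) + 1 ≤ (T + 1) * (N : ℝ) ^ e := le_mul_of_one_le_right (by positivity) hNe
      linarith
    calc (G : ℝ) ≤ 8 * C * ((E N).card * (2 * (w : ℝ) + T + 1)) := by linarith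
      _ ≤ 8 * C * ((N : ℝ) ^ (K * r + e) * ((T + 5) * (N : ℝ) ^ e)) := by gcongr
      _ = 8 * C * (T + 5) * (N : ℝ) ^ (K * r + 2 * e) := by
          rw [show K * r + 2 * e = (K * r + e) + e by ring, Real.rpow_add hN0 (K * r + e)]
          ring
  have hNk : 1 ≤ (N : ℝ) ^ (K * r + 2 * e) := Real.one_le_rpow hN (by positivity)
  linarith

/-! ### Excluding a relation. -/

/-- There is no nontrivial relation whose lexicographically largest monomial `(κ i₀, l i₀)` has
positive coefficient. -/
theorem sum_monomials_ne_zero {β ρ : ℝ} (hβ : IsIntegral ℤ β) (hβ1 : 1 < β)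
    (hconj : ∀ z : ℂ, Polynomial.aeval z (minpoly ℚ β) = 0 → z ≠ (β : ℂ) → ‖z‖ ≤ 1)
    {g : PowerSeries ℕ} (hg : g ∈ classF) {ι : Type*} (T : Finset ι) (κ l : ι → ℕ)
    (p : ι → Polynomial ℤ) {i₀ : ι} (hi₀ : i₀ ∈ T)
    (hlex : ∀ i ∈ T, i ≠ i₀ → κ i < κ i₀ ∨ κ i = κ i₀ ∧ l i < l i₀)
    (hκ : 1 ≤ κ i₀) (hl : 1 ≤ l i₀) (hp : 0 < Polynomial.aeval β (p i₀))
    (h1 : (κ i₀ : ℝ) * (κ i₀ - 1) / 2 < ρ) (h2 : 2 * (κ i₀ : ℝ) - 1 < ρ) :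
    ∑ i ∈ T, Polynomial.aeval β (p i) *
      (gammaSeries ρ β⁻¹ ^ κ i * seriesValue g β⁻¹ ^ l i) ≠ 0 := by
  classical
  intro hsum
  have hκ' : (1 : ℝ) ≤ κ i₀ := by exact_mod_cast hκ
  have hρ : 1 < ρ := by linarith
  have hx0 : 0 ≤ β⁻¹ := inv_nonneg.2 (by linarith)
  have hx1 : β⁻¹ < 1 := inv_lt_one_of_one_lt₀ hβ1
  obtain ⟨e, he0, he1, hτ, hγ⟩ := exists_exponent_slack hκ h1 h2
  have hfb := floorPowSeries_polyBounded ρ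
  have hgb := polyBounded_of_mem_classF hg
  set F : ι → PowerSeries ℕ := fun i => floorPowSeries ρ ^ κ i * g ^ l i with hFdef
  have hF : ∀ i, PolyBounded (F i) := fun i => (hfb.pow _).mul (hgb.pow _)
  obtain ⟨B, D, hdisc, hreal⟩ := exists_polyGrowth_bound T F hF p β
  have hzero := tsum_aeval_sum T F hF p β hx0 hx1
  have hval : ∀ i, seriesValue (F i) β⁻¹ =
      gammaSeries ρ β⁻¹ ^ κ i * seriesValue g β⁻¹ ^ l i := fun i => by
    rw [hFdef, seriesValue_mul (hfb.pow _) (hgb.pow _) hx0 hx1, seriesValue_pow hfb hx0 hx1,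
      seriesValue_pow hgb hx0 hx1, seriesValue_floorPowSeries hρ.le]
  simp only [hval] at hzero
  rw [hsum] at hzero
  obtain ⟨Z, hZ⟩ := exists_nonvanishing_set hβ hβ1 hconj _ B D hdisc hreal hzero he0 hp
  set P := (T.filter fun i => κ i < κ i₀).image fun i => (κ i, l i) with hP
  have hmem : ∀ n, ∀ i ∈ T, n ∈ suppSet (F i) → i ≠ i₀ →
      n ∈ suppUnion (floorPowSeries ρ) g ({κ i₀} ×ˢ Finset.range (l i₀)) ∨
        n ∈ suppUnion (floorPowSeries ρ) g P := by
    intro n i hi hn hne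
    rcases hlex i hi hne with h | ⟨h, h'⟩
    · exact Or.inr ⟨(κ i, l i), Finset.mem_image_of_mem _ (Finset.mem_filter.2 ⟨hi, h⟩), hn⟩
    · exact Or.inl ⟨(κ i, l i), Finset.mem_product.2
        ⟨Finset.mem_singleton.2 h, Finset.mem_range.2 h'⟩, hn⟩
  -- Away from the exponents of the lower monomials, each coefficient is a natural multiple of the
  -- positive leading one.
  have hpure : ∀ n, n ∉ suppUnion (floorPowSeries ρ) g ({κ i₀} ×ˢ Finset.range (l i₀)) →
      n ∉ suppUnion (floorPowSeries ρ) g P →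
      Polynomial.aeval β (∑ i ∈ T, PowerSeries.coeff n (F i) • p i) =
        PowerSeries.coeff n (F i₀) * Polynomial.aeval β (p i₀) := by
    intro n hn1 hn2
    rw [Finset.sum_eq_single_of_mem i₀ hi₀, map_nsmul, nsmul_eq_mul]
    intro i hi hne
    by_cases hc : n ∈ suppSet (F i)
    · exact absurd (hmem n i hi hc hne) (not_or.2 ⟨hn1, hn2⟩)
    · rw [not_not.1 hc, zero_smul]
  refine not_nonvanishing_set hρ hκ hl hg he0 he1 hτ hγ P ?_ Z (hZ.mono fun N hN R hR =>
    ⟨fun hZR => ?_, fun θ hθ hRθ hθΘ hfree => (hN R hR).2 θ hθ hRθ (fun n hn hn' => ?_) ?_⟩)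
  · intro q hq
    obtain ⟨i, hi, rfl⟩ := Finset.mem_image.1 hq
    exact (Finset.mem_filter.1 hi).2
  · obtain ⟨n, hn1, hn2, hn⟩ := (hN R hR).1 hZR
    refine ⟨n, ?_, hn1, hn2⟩
    by_contra hcon
    refine hn ?_
    rw [Set.mem_union, Set.mem_union, not_or, not_or] at hcon
    have hc : PowerSeries.coeff n (F i₀) = 0 := not_not.1 hcon.2
    rw [hpure n hcon.1.1 hcon.1.2, hc, Nat.cast_zero, zero_mul]
  · rw [hpure n (hfree n hn hn').1 (hfree n hn hn').2]
    positivity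
  · have h := hfree θ hRθ (Nat.le_add_right _ _)
    rw [hpure θ h.1 h.2]
    have hc : 1 ≤ PowerSeries.coeff θ (F i₀) := Nat.one_le_iff_ne_zero.2 hθΘ
    exact le_mul_of_one_le_left hp.le (by exact_mod_cast hc)

theorem mainTheorem9 :
    ∃ A₀ : ℝ → ℝ, IsComputableOnPos A₀ ∧ (∀ ε : ℝ, 0 < ε → 0 < A₀ ε) ∧
      ∀ ε : ℝ, 0 < ε → ∀ A : ℕ, A₀ ε ≤ (A : ℝ) →
        ∀ ρ : ℝ, (ε + 1 / 2) * (A : ℝ) ^ 2 < ρ →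
          ∀ g ∈ classF, ∀ β : ℝ, IsPisot β ∨ IsSalem β →
            LinearIndependent (IntermediateField.adjoin ℚ {β})
              (fun k : {k : ℕ × ℕ // k.1 ≤ A} =>
                gammaSeries ρ β⁻¹ ^ k.1.1 * seriesValue g β⁻¹ ^ k.1.2) := by
  classical
  -- 4 is the least integer from which 2A - 1 ≤ A²/2 holds.
  refine ⟨fun _ => (4 : ℕ), isComputableOnPos_natCast 4, fun _ _ => by norm_num, ?_⟩
  intro ε hε A hA ρ hρ g hg β hβ
  have hA4 : (4 : ℝ) ≤ A := hA
  obtain ⟨hint, hβ1, hconj⟩ : IsIntegral ℤ β ∧ 1 < β ∧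
      ∀ z : ℂ, Polynomial.aeval z (minpoly ℚ β) = 0 → z ≠ (β : ℂ) → ‖z‖ ≤ 1 := by
    rcases hβ with ⟨h1, h2, h3⟩ | ⟨h1, h2, h3, -⟩
    · exact ⟨h1, h2, fun z hz hne => (h3 z hz hne).le⟩
    · exact ⟨h1, h2, h3⟩
  rw [linearIndependent_iff']
  intro s c hsum
  by_contra! hcon
  obtain ⟨j, hj, hcj⟩ := hcon
  set S := s.filter fun i => c i ≠ 0 with hS
  obtain ⟨i₀, hi₀, hmax⟩ := S.exists_max_image (fun i => toLex i.1)
    ⟨j, Finset.mem_filter.2 ⟨hj, hcj⟩⟩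
  obtain ⟨b, hb, hden⟩ := exists_common_denominator (β := β) hint.tower_top S c
  choose! p hp using hden
  have hrel : ∑ i ∈ S, Polynomial.aeval β (p i) *
      (gammaSeries ρ β⁻¹ ^ i.1.1 * seriesValue g β⁻¹ ^ i.1.2) = 0 := by
    have h1 : ∑ i ∈ S, c i • (gammaSeries ρ β⁻¹ ^ i.1.1 * seriesValue g β⁻¹ ^ i.1.2) = 0 := by
      rw [← hsum]
      refine Finset.sum_subset (Finset.filter_subset _ _) fun i hi hiS => ?_
      have : c i = 0 := by
        by_contra h
        exact hiS (Finset.mem_filter.2 ⟨hi, h⟩)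
      rw [this, zero_smul]
    calc _ = ∑ i ∈ S, (b : ℝ) *
          (c i • (gammaSeries ρ β⁻¹ ^ i.1.1 * seriesValue g β⁻¹ ^ i.1.2)) :=
        Finset.sum_congr rfl fun i hi => by
          rw [hp i hi, mul_assoc]
          rfl
      _ = 0 := by rw [← Finset.mul_sum, h1, mul_zero]
  have hp₀ : Polynomial.aeval β (p i₀) ≠ 0 := by
    rw [hp i₀ hi₀]
    refine mul_ne_zero (Int.cast_ne_zero.2 hb) fun h => ?_
    exact (Finset.mem_filter.1 hi₀).2 (Subtype.ext h)
  obtain ⟨q, hq, hq₀⟩ : ∃ q : {k : ℕ × ℕ // k.1 ≤ A} → Polynomial ℤ,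
      ∑ i ∈ S, Polynomial.aeval β (q i) *
        (gammaSeries ρ β⁻¹ ^ i.1.1 * seriesValue g β⁻¹ ^ i.1.2) = 0 ∧
      0 < Polynomial.aeval β (q i₀) := by
    rcases lt_or_gt_of_ne hp₀ with h | h
    · refine ⟨fun i => -p i, ?_, by rw [map_neg]; exact neg_pos.2 h⟩
      simp only [map_neg, neg_mul, Finset.sum_neg_distrib, hrel, neg_zero]
    · exact ⟨p, hrel, h⟩
  -- Multiplying by γ^δ g makes both leading exponents positive and preserves the lexicographic
  -- order. The γ-degree stays at most A because δ = 1 only when it is 0.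
  set δ := if i₀.1.1 = 0 then 1 else 0 with hδ
  have hδ1 : 1 ≤ i₀.1.1 + δ := by
    rw [hδ]
    split_ifs with h <;> omega
  have hδA : ((i₀.1.1 + δ : ℕ) : ℝ) ≤ A := by
    have h4 : 4 ≤ A := by exact_mod_cast hA4
    have h5 := i₀.2
    have : i₀.1.1 + δ ≤ A := by
      rw [hδ]
      split_ifs with h <;> omega
    exact_mod_cast this
  have hδ1' : (1 : ℝ) ≤ ((i₀.1.1 + δ : ℕ) : ℝ) := by exact_mod_cast hδ1
  have hρA : (A : ℝ) ^ 2 / 2 < ρ := by nlinarith [mul_pos hε (by positivity : 0 < (A : ℝ) ^ 2)]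
  refine sum_monomials_ne_zero (ρ := ρ) hint hβ1 hconj hg S (fun i => i.1.1 + δ)
    (fun i => i.1.2 + 1) q hi₀ ?_ hδ1 (Nat.le_add_left _ _) hq₀ ?_ ?_ ?_
  · intro i hi hne
    have h1 := (hmax i hi).lt_of_ne fun h => hne (Subtype.ext (toLex.injective h))
    rcases Prod.Lex.lt_iff.1 h1 with h | ⟨h, h'⟩
    · exact Or.inl (Nat.add_lt_add_right h δ)
    · exact Or.inr ⟨congrArg (· + δ) h, Nat.add_lt_add_right h' 1⟩
  · nlinarith
  · nlinarith
  · calc _ = (∑ i ∈ S, Polynomial.aeval β (q i) *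
          (gammaSeries ρ β⁻¹ ^ i.1.1 * seriesValue g β⁻¹ ^ i.1.2)) *
            (gammaSeries ρ β⁻¹ ^ δ * seriesValue g β⁻¹) := by
          rw [Finset.sum_mul]
          refine Finset.sum_congr rfl fun i _ => ?_
          ring
      _ = 0 := by rw [hq, zero_mul]
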